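/- **Theorem (Dynamic Programming Principle).** *Setting.* Let $A,B\subset\mathbb{R}^l$ be compact and non-empty, $U\subset\mathbb{R}^p$ and $V\subset\mathbb{R}^q$ non-empty convex cones, and $\lambda>0$. Let $b:\mathbb{R}^n\times A\times B\to\mathbb{R}^n$ and $f:\mathbb{R}^n\times A\times B\to\mathbb{R}$ be bounded, continuous, and Lipschitz in $x\in\mathbb{R}^n$ uniformly in the other variables. Let $g_\xi:\mathbb{R}^n\times\mathbb{R}^p\to\mathbb{R}^n$ and $g_\eta:\mathbb{R}^n\times\mathbb{R}^q\to\mathbb{R}^n$ be Lipschitz in $x$ uniformly in the second variable. Let $c:\mathbb{R}^n\times U\to(0,\infty)$ and $\chi:\mathbb{R}^n\times V\to(0,\infty)$ be bounded below by a positive constant, Lipschitz in $x$ uniformly in the second variable, and subadditive in the second variable. *Controls.* $\Theta_1$ (resp. $\Theta_2$) is the set of measurable functions $[0,\infty)\to A$ (resp. $B$). $\mathcal U$ is the set of sequences $u=(\tau_m,\xi_m)_{m\ge 0}$ with $\tau_m\in[0,\infty]$ non-decreasing, $\tau_m\to\infty$, and $\xi_m\in U$; $\mathcal V$ is the set of sequences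 $v=(\rho_k,\eta_k)_{k\ge 0}$ of the same kind with $\eta_k\in V$. An impulse with time $\infty$ never takes place. *State.* For an initial state $x$ and controls $(\theta_1,u)\in\Theta_1\times\mathcal U$, $(\theta_2,v)\in\Theta_2\times\mathcal V$, let $y_x$ be the left-continuous trajectory with $y_x(0)=y_x(0^-)=x$ that solves $\dot y_x(t)=b(y_x(t);\theta_1(t),\theta_2(t))$ (in the integrated sense) between impulses and satisfies $$y_x(\tau_m^+)=y_x(\tau_m^-)+g_\xi(y_x(\tau_m^-),\xi_m)\prod_{k\ge0}\mathbf 1_{\{\tau_m\ne\rho_k\}}\ (\xi_m\ne 0),\qquad y_x(\rho_k^+)=y_x(\rho_k^-)+g_\eta(y_x(\rho_k^-),\eta_k)\ (\eta_k\ne 0);$$ an impulse with value $0$ does not move the state. Thus an impulse of the first player at the same time as one of the second player is ignored. Several impulses of one player at the same time are carried out one after the other in the order of their indices, and $y_x(\tau_m^-)$, $y_x(\rho_k^-)$ denote the state immediately before the impulse in question. The value of $y_x$ at a fixed time $T$ is the left limit $y_x(T^-)$. *Payoff.* For $0<T\le\infty$ put $$J_T=\int_0^T f(y_x(t);\theta_1(t),\theta_2(t))e^{-\lambda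 t}dt-\sum_{m\ge0}c(y_x(\tau_m^-),\xi_m)e^{-\lambda\tau_m}\mathbf 1_{\{\tau_m<T\}}\prod_{k\ge0}\mathbf 1_{\{\tau_m\neq\rho_k\}}+\sum_{k\ge0}\chi(y_x(\rho_k^-),\eta_k)e^{-\lambda\rho_k}\mathbf 1_{\{\rho_k<T\}},$$ and $J=J_\infty\in[-\infty,\infty]$, where $J=-\infty$ if both sums are infinite. *Strategies and values.* Two controls of one player agree on $[0,t]$ if their continuous parts coincide at all times $s\le t$ and their impulses with times in $[0,t]$ are the same. A map $\beta:\Theta_1\times\mathcal U\to\Theta_2\times\mathcal V$ is non-anticipative if, for every $t\ge0$, controls that agree on $[0,t]$ are mapped to controls that agree on $[0,t]$; $\mathcal B$ is the set of these maps, and $\mathcal A$ is the set of non-anticipative maps $\alpha:\Theta_2\times\mathcal V\to\Theta_1\times\mathcal U$, defined in the same way. The lower and upper value functions are $$V^-(x)=\inf_{\beta\in\mathcal B}\ \sup_{(\theta_1,u)\in\Theta_1\times\mathcal U}J\bigl(x;\theta_1,u,\beta(\theta_1,u)\bigr),\qquad V^+(x)=\sup_{\alpha\in\mathcal A}\ \inf_{(\theta_2,v)\in\Theta_2\times\mathcal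 V}J\bigl(x;\alpha(\theta_2,v),\theta_2,v\bigr).$$ *Claim.* $V^-$ and $V^+$ are finite on $\mathbb{R}^n$, and for all $x\in\mathbb{R}^n$ and all real $T>0$, $$V^-(x)=\inf_{\beta\in\mathcal B}\ \sup_{(\theta_1,u)\in\Theta_1\times\mathcal U}\Bigl\{J_T\bigl(x;\theta_1,u,\beta(\theta_1,u)\bigr)+e^{-\lambda T}\,V^-\bigl(y_x(T;\theta_1,u,\beta(\theta_1,u))\bigr)\Bigr\},$$ $$V^+(x)=\sup_{\alpha\in\mathcal A}\ \inf_{(\theta_2,v)\in\Theta_2\times\mathcal V}\Bigl\{J_T\bigl(x;\alpha(\theta_2,v),\theta_2,v\bigr)+e^{-\lambda T}\,V^+\bigl(y_x(T;\alpha(\theta_2,v),\theta_2,v)\bigr)\Bigr\}.$$ -/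

import Mathlib

open Filter Topology MeasureTheory
open scoped NNReal ENNReal

/-- An impulse control with actions in the convex cone `U`: a non-decreasing sequence of times in
`[0, ∞]` tending to `∞`, and a sequence of actions in `U`. A time `∞` means that the impulse never
takes place. -/
structure ImpulseControl {N : ℕ} (U : ConvexCone ℝ (EuclideanSpace ℝ (Fin N))) where
  time : ℕ → ℝ≥0∞
  act : ℕ → U
  monotone_time : Monotone time
  tendsto_time : Tendsto time atTop (𝓝 ⊤)

/-- A full control of one player: a measurable `A`-valued function of the time `t ≥ 0`, together
with an impulse control. -/
structure GameControl {l N : ℕ} (A : Set (EuclideanSpace ℝ (Fin l)))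
    (U : ConvexCone ℝ (EuclideanSpace ℝ (Fin N))) where
  cont : ℝ≥0 → A
  measurable_cont : Measurable cont
  imp : ImpulseControl U

/-- Two controls agree on `[0, t]`: their continuous parts coincide at every time `s ≤ t`, and
their impulses with time in `[0, t]` are the same. -/
def GameControl.AgreeUpTo {l N : ℕ} {A : Set (EuclideanSpace ℝ (Fin l))}
    {U : ConvexCone ℝ (EuclideanSpace ℝ (Fin N))} (t : ℝ≥0) (a a' : GameControl A U) : Prop :=
  (∀ s ≤ t, a.cont s = a'.cont s) ∧
    ∀ m, (a.imp.time m ≤ t ∨ a'.imp.time m ≤ t) →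
      a.imp.time m = a'.imp.time m ∧ a.imp.act m = a'.imp.act m

/-- Non-anticipative maps from the controls of one player to the controls of the other. -/
def NonAnticipative {l N N' : ℕ} {A B : Set (EuclideanSpace ℝ (Fin l))}
    {U : ConvexCone ℝ (EuclideanSpace ℝ (Fin N))} {V : ConvexCone ℝ (EuclideanSpace ℝ (Fin N'))}
    (α : GameControl A U → GameControl B V) : Prop :=
  ∀ (t : ℝ≥0) (a a' : GameControl A U), a.AgreeUpTo t a' → (α a).AgreeUpTo t (α a')

/-- The displacement caused by the impulse `ξ` at the state `x`: the jump relation is imposed only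
for `ξ ≠ 0`, so a zero impulse does not move the state. -/
noncomputable def impulseJump {n N : ℕ}
    (g : EuclideanSpace ℝ (Fin n) → EuclideanSpace ℝ (Fin N) → EuclideanSpace ℝ (Fin n))
    (x : EuclideanSpace ℝ (Fin n)) (ξ : EuclideanSpace ℝ (Fin N)) : EuclideanSpace ℝ (Fin n) :=
  open Classical in if ξ = 0 then 0 else g x ξ

/-- The state just before the `m`-th impulse of `u`, where `y` is the left-continuous trajectory.
It is the left limit `y (time m)`; if the same player has several impulses at one time, they are
executed one after the other, in the order of their indices. -/
noncomputable def stateBefore {n N : ℕ} {U : ConvexCone ℝ (EuclideanSpace ℝ (Fin N))}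
    (g : EuclideanSpace ℝ (Fin n) → EuclideanSpace ℝ (Fin N) → EuclideanSpace ℝ (Fin n))
    (u : ImpulseControl U) (y : ℝ≥0 → EuclideanSpace ℝ (Fin n)) : ℕ → EuclideanSpace ℝ (Fin n)
  | 0 => y (u.time 0).toNNReal
  | m + 1 =>
    open Classical in
    if u.time (m + 1) = u.time m then
      stateBefore g u y m + impulseJump g (stateBefore g u y m) (u.act m)
    else y (u.time (m + 1)).toNNReal

/-- The data of the game. The first player (`A`, `U`, `gξ`, `c`) maximizes, the second player
(`B`, `V`, `gη`, `χ`) minimizes. -/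
structure ImpulseGame (n p q l : ℕ) where
  A : Set (EuclideanSpace ℝ (Fin l))
  B : Set (EuclideanSpace ℝ (Fin l))
  U : ConvexCone ℝ (EuclideanSpace ℝ (Fin p))
  V : ConvexCone ℝ (EuclideanSpace ℝ (Fin q))
  b : EuclideanSpace ℝ (Fin n) → A → B → EuclideanSpace ℝ (Fin n)
  gξ : EuclideanSpace ℝ (Fin n) → EuclideanSpace ℝ (Fin p) → EuclideanSpace ℝ (Fin n)
  gη : EuclideanSpace ℝ (Fin n) → EuclideanSpace ℝ (Fin q) → EuclideanSpace ℝ (Fin n)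
  f : EuclideanSpace ℝ (Fin n) → A → B → ℝ
  c : EuclideanSpace ℝ (Fin n) → U → ℝ
  χ : EuclideanSpace ℝ (Fin n) → V → ℝ
  lam : ℝ

namespace ImpulseGame

variable {n p q l : ℕ}

/-- Standing conventions: compact non-empty sets of control values, non-empty cones, and a
positive discount factor. -/
structure Standing (G : ImpulseGame n p q l) : Prop where
  compact_A : IsCompact G.A
  compact_B : IsCompact G.B
  nonempty_A : G.A.Nonempty
  nonempty_B : G.B.Nonempty
  nonempty_U : (G.U : Set (EuclideanSpace ℝ (Fin p))).Nonempty
  nonempty_V : (G.V : Set (EuclideanSpace ℝ (Fin q))).Nonempty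
  lam_pos : 0 < G.lam

/-- The dynamics is bounded, continuous, and Lipschitz in the state uniformly in the controls. -/
structure HypDynamics (G : ImpulseGame n p q l) : Prop where
  lipschitz : ∃ C > 0, ∀ x y θ₁ θ₂, ‖G.b x θ₁ θ₂ - G.b y θ₁ θ₂‖ ≤ C * ‖x - y‖
  continuous : Continuous fun z : EuclideanSpace ℝ (Fin n) × G.A × G.B => G.b z.1 z.2.1 z.2.2
  bounded : ∃ M, ∀ x θ₁ θ₂, ‖G.b x θ₁ θ₂‖ ≤ M

/-- The impulse maps are Lipschitz in the state uniformly in the action. -/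
structure HypImpulseForm (G : ImpulseGame n p q l) : Prop where
  lipschitz_gξ : ∃ C > 0, ∀ x y ξ, ‖G.gξ x ξ - G.gξ y ξ‖ ≤ C * ‖x - y‖
  lipschitz_gη : ∃ C > 0, ∀ x y η, ‖G.gη x η - G.gη y η‖ ≤ C * ‖x - y‖

/-- The running gain is bounded, continuous, and Lipschitz in the state uniformly in the
controls. -/
structure HypRunningGain (G : ImpulseGame n p q l) : Prop where
  lipschitz : ∃ C > 0, ∀ x y θ₁ θ₂, |G.f x θ₁ θ₂ - G.f y θ₁ θ₂| ≤ C * ‖x - y‖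
  continuous : Continuous fun z : EuclideanSpace ℝ (Fin n) × G.A × G.B => G.f z.1 z.2.1 z.2.2
  bounded : ∃ M, ∀ x θ₁ θ₂, |G.f x θ₁ θ₂| ≤ M

/-- The impulse costs are bounded below by a positive constant, Lipschitz in the state uniformly in
the action, and subadditive in the action. -/
structure HypImpulseCost (G : ImpulseGame n p q l) : Prop where
  inf_c_pos : ∃ δ > 0, ∀ x ξ, δ ≤ G.c x ξ
  inf_χ_pos : ∃ δ > 0, ∀ x η, δ ≤ G.χ x η
  lipschitz_c : ∃ C > 0, ∀ x y ξ, |G.c x ξ - G.c y ξ| ≤ C * ‖x - y‖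
  lipschitz_χ : ∃ C > 0, ∀ x y η, |G.χ x η - G.χ y η| ≤ C * ‖x - y‖
  subadditive_c : ∀ x (ξ₁ ξ₂ : G.U),
    G.c x ⟨ξ₁ + ξ₂, G.U.add_mem ξ₁.2 ξ₂.2⟩ ≤ G.c x ξ₁ + G.c x ξ₂
  subadditive_χ : ∀ x (η₁ η₂ : G.V),
    G.χ x ⟨η₁ + η₂, G.V.add_mem η₁.2 η₂.2⟩ ≤ G.χ x η₁ + G.χ x η₂

/-- `y` is the left-continuous state trajectory with `y 0 = y(0⁻) = x` generated by the controls
`a₁`, `a₂`: between impulses it solves the differential equation (in the integrated sense), at an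
impulse time it jumps, and an impulse of the first player that occurs at the same time as one of
the second player has no effect. Only finitely many terms of each sum are non-zero. -/
def IsTrajectory (G : ImpulseGame n p q l) (x : EuclideanSpace ℝ (Fin n))
    (a₁ : GameControl G.A G.U) (a₂ : GameControl G.B G.V)
    (y : ℝ≥0 → EuclideanSpace ℝ (Fin n)) : Prop :=
  open Classical in
  ∀ t : ℝ≥0,
    IntervalIntegrable
      (fun s : ℝ => G.b (y s.toNNReal) (a₁.cont s.toNNReal) (a₂.cont s.toNNReal)) volume 0 t ∧
    y t = x
      + (∫ s in (0 : ℝ)..t, G.b (y s.toNNReal) (a₁.cont s.toNNReal) (a₂.cont s.toNNReal))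
      + (∑' m, if a₁.imp.time m < t ∧ ∀ k, a₁.imp.time m ≠ a₂.imp.time k then
          impulseJump G.gξ (stateBefore G.gξ a₁.imp y m) (a₁.imp.act m) else 0)
      + (∑' k, if a₂.imp.time k < t then
          impulseJump G.gη (stateBefore G.gη a₂.imp y k) (a₂.imp.act k) else 0)

/-- The trajectory of the system from `x` under the controls `a₁`, `a₂`. Its value at an impulse
time is the left limit there. -/
noncomputable def trajectory (G : ImpulseGame n p q l) (x : EuclideanSpace ℝ (Fin n))
    (a₁ : GameControl G.A G.U) (a₂ : GameControl G.B G.V) : ℝ≥0 → EuclideanSpace ℝ (Fin n) :=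
  open Classical in
  if h : ∃ y, G.IsTrajectory x a₁ a₂ y then h.choose else fun _ => x

/-- Discounted cost of the first player's effective impulses with time `< T` (for `T = ∞`, of all
its effective impulses). -/
noncomputable def costMax (G : ImpulseGame n p q l) (T : ℝ≥0∞) (x : EuclideanSpace ℝ (Fin n))
    (a₁ : GameControl G.A G.U) (a₂ : GameControl G.B G.V) : ℝ≥0∞ :=
  open Classical in
  ∑' m, if a₁.imp.time m < T ∧ ∀ k, a₁.imp.time m ≠ a₂.imp.time k then
    ENNReal.ofReal (G.c (stateBefore G.gξ a₁.imp (G.trajectory x a₁ a₂) m) (a₁.imp.act m)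
      * Real.exp (-G.lam * (a₁.imp.time m).toReal)) else 0

/-- Discounted cost of the second player's impulses with time `< T` (for `T = ∞`, of all its
impulses). -/
noncomputable def costMin (G : ImpulseGame n p q l) (T : ℝ≥0∞) (x : EuclideanSpace ℝ (Fin n))
    (a₁ : GameControl G.A G.U) (a₂ : GameControl G.B G.V) : ℝ≥0∞ :=
  open Classical in
  ∑' k, if a₂.imp.time k < T then
    ENNReal.ofReal (G.χ (stateBefore G.gη a₂.imp (G.trajectory x a₁ a₂) k) (a₂.imp.act k)
      * Real.exp (-G.lam * (a₂.imp.time k).toReal)) else 0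

/-- The discounted running gain at time `t`. -/
noncomputable def discountedGain (G : ImpulseGame n p q l) (x : EuclideanSpace ℝ (Fin n))
    (a₁ : GameControl G.A G.U) (a₂ : GameControl G.B G.V) (t : ℝ) : ℝ :=
  G.f (G.trajectory x a₁ a₂ t.toNNReal) (a₁.cont t.toNNReal) (a₂.cont t.toNNReal)
    * Real.exp (-G.lam * t)

/-- The gain/cost functional. Total impulse costs may be infinite, so it takes extended real
values; if both totals are infinite the value is `⊥`. -/
noncomputable def J (G : ImpulseGame n p q l) (x : EuclideanSpace ℝ (Fin n))
    (a₁ : GameControl G.A G.U) (a₂ : GameControl G.B G.V) : EReal :=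
  ((∫ t in Set.Ioi (0 : ℝ), G.discountedGain x a₁ a₂ t : ℝ) : EReal)
    - (G.costMax ⊤ x a₁ a₂ : EReal) + (G.costMin ⊤ x a₁ a₂ : EReal)

/-- The non-anticipative strategies of the first (maximizing) player. -/
def StrategyMax (G : ImpulseGame n p q l) : Type :=
  {α : GameControl G.B G.V → GameControl G.A G.U // NonAnticipative α}

/-- The non-anticipative strategies of the second (minimizing) player. -/
def StrategyMin (G : ImpulseGame n p q l) : Type :=
  {β : GameControl G.A G.U → GameControl G.B G.V // NonAnticipative β}

/-- The lower value function `V⁻`. -/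
noncomputable def lowerValue (G : ImpulseGame n p q l) (x : EuclideanSpace ℝ (Fin n)) : EReal :=
  ⨅ β : G.StrategyMin, ⨆ a₁ : GameControl G.A G.U, G.J x a₁ (β.1 a₁)

/-- The upper value function `V⁺`. -/
noncomputable def upperValue (G : ImpulseGame n p q l) (x : EuclideanSpace ℝ (Fin n)) : EReal :=
  ⨆ α : G.StrategyMax, ⨅ a₂ : GameControl G.B G.V, G.J x (α.1 a₂) a₂

end ImpulseGame

/-! Cut every control at `T` into its part on `[0, T)` and a remainder whose clock restarts at `T`.
The state equation has exactly one global solution (`isTrajectory_trajectory`, `IsTrajectoryOn.eq`),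
so trajectories have the flow property `trajectory_add`, and `J_eq_payoffBefore_add` splits the
payoff: `J` from `x` is `payoffBefore` plus `exp (-λT)` times `J` of the shifted controls from the
state at `T`. Both `payoffBefore` and that state see only the controls on `[0, T)`. Impulses at `T`
itself belong to the continuation, in accordance with the left limit at `T`.

Once the payoff splits, the principle is formal (`dynamicProgramming`). For `≤`, follow a given
strategy before `T` and then a nearly optimal one for the state reached; the result is
non-anticipative because that state is fixed by what was played before `T`
(`nonAnticipative_concat`). For `≥`, a strategy together with a fixed past of the opponent induces a
strategy for the game restarted at `T` (`nonAnticipative_shift`); its worst case is at least the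
value there.

The upper value is covered by the same abstract statement, applied to `-J` with the players
exchanged. Finiteness holds because the running gain has a uniformly bounded integral and either
player may refrain from impulses. -/

/-! ### Gronwall's inequality and Carathéodory differential equations -/

/-- An integral form of Gronwall's inequality with zero initial value. -/
theorem eq_zero_of_le_integral {u : ℝ → ℝ} {C s T : ℝ} (hC : 0 ≤ C)
    (hu : ContinuousOn u (Set.Icc s T)) (h0 : ∀ t ∈ Set.Icc s T, 0 ≤ u t)
    (hle : ∀ t ∈ Set.Icc s T, u t ≤ C * ∫ r in s..t, u r) :
    ∀ t ∈ Set.Icc s T, u t = 0 := by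
  intro t ht
  have hsT : s ≤ T := ht.1.trans ht.2
  -- The continuous extension makes the primitive differentiable at every point, endpoints included.
  set w : ℝ → ℝ := Set.IccExtend hsT (Set.domRestrict (Set.Icc s T) u) with hw
  have hwc : Continuous w := (continuousOn_iff_continuous_domRestrict.1 hu).Icc_extend'
  have hwu : ∀ r ∈ Set.Icc s T, w r = u r := fun r hr => by
    rw [hw, Set.IccExtend_of_mem _ _ hr]; rfl
  have hint : ∀ r ∈ Set.Icc s T, ∫ a in s..r, u a = ∫ a in s..r, w a := fun r hr => by
    refine intervalIntegral.integral_congr fun a ha => (hwu a ?_).symm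
    rw [Set.uIcc_of_le hr.1] at ha
    exact ⟨ha.1, ha.2.trans hr.2⟩
  have hd : ∀ r, HasDerivAt (fun r => ∫ a in s..r, w a) (w r) r := fun r =>
    intervalIntegral.integral_hasDerivAt_right (hwc.intervalIntegrable _ _)
      hwc.stronglyMeasurable.stronglyMeasurableAtFilter hwc.continuousAt
  have hnn : ∀ r ∈ Set.Icc s T, 0 ≤ ∫ a in s..r, w a := fun r hr =>
    intervalIntegral.integral_nonneg hr.1 fun a ha => by
      rw [hwu a ⟨ha.1, ha.2.trans hr.2⟩]; exact h0 a ⟨ha.1, ha.2.trans hr.2⟩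
  -- Gronwall is applied to the primitive: its derivative `w` is at most `C` times the primitive
  -- itself, which vanishes at `s`.
  have key := norm_le_gronwallBound_of_norm_deriv_right_le (f := fun r => ∫ a in s..r, w a)
    (f' := w) (δ := 0) (K := C) (ε := 0) (a := s) (b := T)
    (fun r _ => (hd r).continuousAt.continuousWithinAt)
    (fun r _ => (hd r).hasDerivWithinAt) (by simp)
    (fun r hr => by
      have hr' : r ∈ Set.Icc s T := ⟨hr.1, hr.2.le⟩
      rw [hwu r hr', Real.norm_of_nonneg (h0 r hr'), Real.norm_of_nonneg (hnn r hr'), add_zero,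
        ← hint r hr']
      exact hle r hr') t ht
  rw [gronwallBound_ε0_δ0, Real.norm_of_nonneg (hnn t ht), ← hint t ht] at key
  exact le_antisymm ((hle t ht).trans (mul_nonpos_of_nonneg_of_nonpos hC key)) (h0 t ht)

theorem intervalIntegrable_of_norm_le {E : Type*} [NormedAddCommGroup E] {h : ℝ → E} {M : ℝ} (hm : AEStronglyMeasurable h volume)
    (hb : ∀ t, ‖h t‖ ≤ M) (a b : ℝ) : IntervalIntegrable h volume a b :=
  (intervalIntegrable_const (c := M)).mono_fun hm.restrict
    (ae_of_all _ fun t => (hb t).trans (le_abs_self M))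

section Caratheodory

variable {E : Type*} [NormedAddCommGroup E] [NormedSpace ℝ E]

/-- The Picard operator in exponentially weighted form. -/
noncomputable def picardWeighted (F : ℝ → E → E) (K s : ℝ) (z : E) (w : ℝ → E) (t : ℝ) : E :=
  Real.exp (-(K * (max t s - s))) • ∫ r in s..max t s, F r (z + Real.exp (K * (r - s)) • w r)

variable {F : ℝ → E → E} {C M : ℝ}

theorem continuous_picardWeighted
    (hbd : ∀ t x, ‖F t x‖ ≤ M)
    (hmeas : ∀ φ : ℝ → E, Continuous φ → AEStronglyMeasurable (fun t => F t (φ t)) volume)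
    (K s : ℝ) (z : E) {w : ℝ → E} (hw : Continuous w) :
    Continuous (picardWeighted F K s z w) := by
  have h1 : Continuous fun t => ∫ r in s..t, F r (z + Real.exp (K * (r - s)) • w r) :=
    intervalIntegral.continuous_primitive (fun a b =>
      intervalIntegrable_of_norm_le (hmeas _ (by fun_prop)) (fun t => hbd _ _) a b) s
  have h2 : Continuous fun t : ℝ => max t s := by fun_prop
  exact Continuous.smul (by fun_prop) (h1.comp h2)

/-- The integral grows at most linearly, and `u * exp (-K u) ≤ 1 / K`. The weight thus brings the
iteration into the bounded continuous functions on the whole line, and no gluing of local solutions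
is needed. -/
theorem norm_picardWeighted_le (hbd : ∀ t x, ‖F t x‖ ≤ M) {K : ℝ} (hK : 0 < K) (s : ℝ) (z : E)
    (w : ℝ → E) (t : ℝ) : ‖picardWeighted F K s z w t‖ ≤ M / K := by
  have hM : 0 ≤ M := (norm_nonneg _).trans (hbd 0 0)
  have hu : 0 ≤ max t s - s := sub_nonneg.2 (le_max_right _ _)
  have h1 : ‖∫ r in s..max t s, F r (z + Real.exp (K * (r - s)) • w r)‖ ≤ M * (max t s - s) := by
    have := intervalIntegral.norm_integral_le_of_norm_le_const (a := s) (b := max t s) (C := M)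
      (f := fun r => F r (z + Real.exp (K * (r - s)) • w r)) (fun r _ => hbd _ _)
    rwa [abs_of_nonneg hu] at this
  rw [picardWeighted, norm_smul, Real.norm_of_nonneg (Real.exp_pos _).le, Real.exp_neg,
    le_div_iff₀ hK, inv_mul_eq_div, div_mul_eq_mul_div, div_le_iff₀ (Real.exp_pos _)]
  have h2 := Real.add_one_le_exp (K * (max t s - s))
  calc _ ≤ M * (max t s - s) * K := by gcongr
    _ = M * (K * (max t s - s)) := by ring
    _ ≤ _ := by gcongr; linarith

/-- Integrating `C d exp (2C (r - s))` gives at most `d / 2` times `exp (2C (T - s))`, and the outer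
weight cancels this exponential. The rate `2C` is what produces the contraction factor `1 / 2`. -/
theorem norm_picardWeighted_sub_le (hC : 0 < C) (hlip : ∀ t x y, ‖F t x - F t y‖ ≤ C * ‖x - y‖)
    (hbd : ∀ t x, ‖F t x‖ ≤ M)
    (hmeas : ∀ φ : ℝ → E, Continuous φ → AEStronglyMeasurable (fun t => F t (φ t)) volume)
    (s : ℝ) (z : E) {w w' : ℝ → E} (hw : Continuous w) (hw' : Continuous w') {d : ℝ}
    (hd : ∀ t, ‖w t - w' t‖ ≤ d) (t : ℝ) :
    ‖picardWeighted F (2 * C) s z w t - picardWeighted F (2 * C) s z w' t‖ ≤ 1 / 2 * d := by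
  have hd0 : 0 ≤ d := (norm_nonneg _).trans (hd 0)
  have hst : s ≤ max t s := le_max_right _ _
  set T := max t s
  have hi : ∀ v : ℝ → E, Continuous v →
      IntervalIntegrable (fun r => F r (z + Real.exp (2 * C * (r - s)) • v r)) volume s T :=
    fun v hv => intervalIntegrable_of_norm_le (hmeas _ (by fun_prop)) (fun t => hbd _ _) _ _
  have h1 : ‖∫ r in s..T, (F r (z + Real.exp (2 * C * (r - s)) • w r)
      - F r (z + Real.exp (2 * C * (r - s)) • w' r))‖
      ≤ ∫ r in s..T, C * d * Real.exp (2 * C * (r - s)) := by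
    refine intervalIntegral.norm_integral_le_of_norm_le hst (ae_of_all _ fun r _ => ?_)
      (Continuous.intervalIntegrable (by fun_prop) _ _)
    refine (hlip _ _ _).trans ?_
    rw [add_sub_add_left_eq_sub, ← smul_sub, norm_smul, Real.norm_of_nonneg (Real.exp_pos _).le]
    have := mul_le_mul_of_nonneg_left (hd r) (Real.exp_pos (2 * C * (r - s))).le
    nlinarith
  have h2 : ∫ r in s..T, C * d * Real.exp (2 * C * (r - s))
      = d / 2 * (Real.exp (2 * C * (T - s)) - 1) := by
    have hder : ∀ r ∈ Set.uIcc s T, HasDerivAt (fun r => d / 2 * Real.exp (2 * C * (r - s)))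
        (C * d * Real.exp (2 * C * (r - s))) r := fun r _ => by
      have := ((((hasDerivAt_id r).sub_const s).const_mul (2 * C)).exp).const_mul (d / 2)
      refine this.congr_deriv ?_
      simp only [id]
      ring
    rw [intervalIntegral.integral_eq_sub_of_hasDerivAt hder
      (Continuous.intervalIntegrable (by fun_prop) _ _)]
    simp; ring
  rw [picardWeighted, picardWeighted, ← smul_sub, ← intervalIntegral.integral_sub (hi w hw)
    (hi w' hw'), norm_smul, Real.norm_of_nonneg (Real.exp_pos _).le, Real.exp_neg, inv_mul_eq_div,
    div_le_iff₀ (Real.exp_pos _)]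
  rw [h2] at h1
  nlinarith [Real.exp_pos (2 * C * (T - s))]

/-- Global existence for a Carathéodory differential equation with bounded right-hand side. -/
theorem exists_solution_integral_equation [CompleteSpace E] (hC : 0 < C)
    (hlip : ∀ t x y, ‖F t x - F t y‖ ≤ C * ‖x - y‖) (hbd : ∀ t x, ‖F t x‖ ≤ M)
    (hmeas : ∀ φ : ℝ → E, Continuous φ → AEStronglyMeasurable (fun t => F t (φ t)) volume)
    (s : ℝ) (z : E) :
    ∃ φ : ℝ → E, Continuous φ ∧ ∀ t, s ≤ t → φ t = z + ∫ r in s..t, F r (φ r) := by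
  have hK : 0 < 2 * C := by positivity
  let Φ : BoundedContinuousFunction ℝ E → BoundedContinuousFunction ℝ E := fun w =>
    BoundedContinuousFunction.ofNormedAddCommGroup (picardWeighted F (2 * C) s z w)
      (continuous_picardWeighted hbd hmeas _ s z w.continuous) (M / (2 * C))
      (norm_picardWeighted_le hbd hK s z w)
  have hΦ : ContractingWith (1 / 2) Φ := by
    refine ⟨by rw [← NNReal.coe_lt_coe]; norm_num, LipschitzWith.of_dist_le_mul fun w w' => ?_⟩
    rw [BoundedContinuousFunction.dist_le (by positivity)]
    intro t
    rw [dist_eq_norm]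
    have := norm_picardWeighted_sub_le hC hlip hbd hmeas s z w.continuous w'.continuous
      (d := dist w w') (fun t => by
        rw [← dist_eq_norm]; exact BoundedContinuousFunction.dist_coe_le_dist t) t
    simpa [Φ] using this
  set w := hΦ.fixedPoint Φ
  have hw : Φ w = w := hΦ.fixedPoint_isFixedPt
  refine ⟨fun t => z + Real.exp (2 * C * (t - s)) • w t, by fun_prop, fun t ht => ?_⟩
  have h1 : w t = picardWeighted F (2 * C) s z w t := by
    conv_lhs => rw [← hw]
    rfl
  simp only [h1, picardWeighted, max_eq_left ht, smul_smul, ← Real.exp_add, add_neg_cancel,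
    Real.exp_zero, one_smul]

/-- Uniqueness for a Carathéodory differential equation. The values at the initial time do not
matter. -/
theorem eq_of_integral_equation (hC : 0 < C) (hlip : ∀ t x y, ‖F t x - F t y‖ ≤ C * ‖x - y‖)
    {s T : ℝ} {z : E} {φ ψ : ℝ → E}
    (hφi : IntervalIntegrable (fun r => F r (φ r)) volume s T)
    (hψi : IntervalIntegrable (fun r => F r (ψ r)) volume s T)
    (hφ : ∀ t ∈ Set.Ioc s T, φ t = z + ∫ r in s..t, F r (φ r))
    (hψ : ∀ t ∈ Set.Ioc s T, ψ t = z + ∫ r in s..t, F r (ψ r)) :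
    ∀ t ∈ Set.Ioc s T, φ t = ψ t := by
  intro t ht
  have hsT : s ≤ T := ht.1.le.trans ht.2
  have hd : IntervalIntegrable (fun r => F r (φ r) - F r (ψ r)) volume s T := hφi.sub hψi
  have hsub : ∀ {r}, r ∈ Set.Icc s T → Set.uIcc s r ⊆ Set.uIcc s T := fun {r} hr => by
    rw [Set.uIcc_of_le hr.1, Set.uIcc_of_le hsT]; exact Set.Icc_subset_Icc_right hr.2
  -- Gronwall is run on this integral and not on `‖φ - ψ‖`: the integral is continuous and zero at
  -- `s`, whereas nothing is known about `φ s` and `ψ s`.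
  have hDc : ContinuousOn (fun r => ∫ a in s..r, ‖F a (φ a) - F a (ψ a)‖) (Set.Icc s T) := by
    have := intervalIntegral.continuousOn_primitive_interval (μ := volume)
      (f := fun a => ‖F a (φ a) - F a (ψ a)‖) (a := s) (b := T) (by
        rw [Set.uIcc_of_le hsT, integrableOn_Icc_iff_integrableOn_Ioc]
        exact (intervalIntegrable_iff_integrableOn_Ioc_of_le hsT).1 hd.norm)
    rwa [Set.uIcc_of_le hsT] at this
  have hdist : ∀ r ∈ Set.Ioc s T, ‖φ r - ψ r‖ ≤ ∫ a in s..r, ‖F a (φ a) - F a (ψ a)‖ :=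
    fun r hr => by
      have hs := hsub ⟨hr.1.le, hr.2⟩
      rw [hφ r hr, hψ r hr, add_sub_add_left_eq_sub,
        ← intervalIntegral.integral_sub (hφi.mono_set hs) (hψi.mono_set hs)]
      exact intervalIntegral.norm_integral_le_integral_norm hr.1.le
  have hzero := eq_zero_of_le_integral (C := C) hC.le hDc
    (fun r hr => intervalIntegral.integral_nonneg hr.1 fun _ _ => norm_nonneg _)
    (fun r hr => by
      rw [← intervalIntegral.integral_const_mul]
      refine intervalIntegral.integral_mono_on_of_le_Ioo hr.1 (hd.norm.mono_set (hsub hr)) ?_ ?_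
      · refine ContinuousOn.intervalIntegrable ?_
        rw [Set.uIcc_of_le hr.1]
        exact continuousOn_const.mul (hDc.mono (Set.Icc_subset_Icc_right hr.2))
      · intro a ha
        refine (hlip _ _ _).trans ?_
        exact mul_le_mul_of_nonneg_left (hdist a ⟨ha.1, ha.2.le.trans hr.2⟩) hC.le)
    t ⟨ht.1.le, ht.2⟩
  have := hdist t ht
  rw [hzero] at this
  exact sub_eq_zero.1 (norm_le_zero_iff.1 this)

end Caratheodory

/-! ### Existence and uniqueness of the state trajectory -/

/-- Induction along a set of times with finitely many elements before each time: a property that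
holds at `0` and extends across intervals without elements of the set holds at all times. -/
theorem NNReal.induction_on_gaps {D : Set ℝ≥0} (hD : ∀ T, (D ∩ Set.Iio T).Finite)
    {P : ℝ≥0 → Prop} (h0 : P 0)
    (step : ∀ s T, s < T → D ∩ Set.Ioo s T = ∅ → P s → P T) (T : ℝ≥0) : P T := by
  induction hk : (D ∩ Set.Iio T).ncard using Nat.strong_induction_on generalizing T with
  | _ k ih =>
    rcases eq_or_ne T 0 with rfl | hT
    · exact h0
    rcases (D ∩ Set.Iio T).eq_empty_or_nonempty with he | hne
    · refine step 0 T (pos_iff_ne_zero.2 hT) (Set.subset_eq_empty ?_ he) h0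
      exact Set.inter_subset_inter_right _ fun r hr => hr.2
    -- The last element `s` of `D` before `T` leaves a gap `(s, T)`, and it is no longer counted
    -- among the elements before `s`.
    · obtain ⟨s, hs, hmax⟩ := (hD T).exists_maximalFor id _ hne
      refine step s T hs.2 (Set.eq_empty_of_forall_notMem fun r hr => ?_)
        (ih _ (hk ▸ Set.ncard_lt_ncard ?_ (hD T)) s rfl)
      · exact (hmax ⟨hr.1, hr.2.2⟩ hr.2.1.le).not_gt hr.2.1
      · exact ⟨fun r hr => ⟨hr.1, (Set.mem_Iio.1 hr.2).trans hs.2⟩, fun h => lt_irrefl s (h hs).2⟩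

namespace ImpulseControl

variable {n N : ℕ} {U : ConvexCone ℝ (EuclideanSpace ℝ (Fin N))}

theorem finite_time_lt (u : ImpulseControl U) (T : ℝ≥0) : {m | u.time m < T}.Finite := by
  obtain ⟨N, hN⟩ := eventually_atTop.1
    (u.tendsto_time.eventually (lt_mem_nhds (ENNReal.coe_lt_top (r := T))))
  refine (Set.finite_lt_nat N).subset fun m hm => ?_
  by_contra h
  exact lt_asymm hm (hN m (not_lt.1 h))

/-- The recursion only runs back through impulses simultaneous with the `m`-th, and the first of
these reads the trajectory at their common time. -/
theorem stateBefore_congr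
    (g : EuclideanSpace ℝ (Fin n) → EuclideanSpace ℝ (Fin N) → EuclideanSpace ℝ (Fin n))
    (u : ImpulseControl U) {y y' : ℝ≥0 → EuclideanSpace ℝ (Fin n)} (m : ℕ)
    (h : y (u.time m).toNNReal = y' (u.time m).toNNReal) :
    stateBefore g u y m = stateBefore g u y' m := by
  induction m with
  | zero => exact h
  | succ m ih =>
    rw [stateBefore, stateBefore]
    split_ifs with he
    · rw [ih (he ▸ h)]
    · exact h

/-- The finite impulse times. -/
def times (u : ImpulseControl U) : Set ℝ≥0 := {t | ∃ m, u.time m = t}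

theorem finite_times_inter_Iio (u : ImpulseControl U) (T : ℝ≥0) :
    (u.times ∩ Set.Iio T).Finite := by
  refine ((u.finite_time_lt T).image fun m => (u.time m).toNNReal).subset ?_
  rintro t ⟨⟨m, hm⟩, ht⟩
  refine ⟨m, ?_, by simp [hm]⟩
  simp only [Set.mem_ofPred_eq, hm]
  exact_mod_cast ht

theorem toNNReal_mem_times (u : ImpulseControl U) {m : ℕ} {T : ℝ≥0} (h : u.time m < T) :
    (u.time m).toNNReal ∈ u.times ∧ (u.time m).toNNReal < T := by
  have hne : u.time m ≠ ⊤ := (h.trans_le le_top).ne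
  refine ⟨⟨m, (ENNReal.coe_toNNReal hne).symm⟩, ?_⟩
  rwa [← ENNReal.coe_lt_coe, ENNReal.coe_toNNReal hne]

end ImpulseControl

namespace ImpulseGame

variable {n p q l : ℕ} {G : ImpulseGame n p q l} {x : EuclideanSpace ℝ (Fin n)}
  {a₁ : GameControl G.A G.U} {a₂ : GameControl G.B G.V}
  {y y' : ℝ≥0 → EuclideanSpace ℝ (Fin n)}

/-- The velocity along `y`. -/
def drift (G : ImpulseGame n p q l) (a₁ : GameControl G.A G.U) (a₂ : GameControl G.B G.V)
    (y : ℝ≥0 → EuclideanSpace ℝ (Fin n)) (s : ℝ) : EuclideanSpace ℝ (Fin n) :=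
  G.b (y s.toNNReal) (a₁.cont s.toNNReal) (a₂.cont s.toNNReal)

/-- The displacement caused by the effective impulses before `t`. -/
noncomputable def jumps (G : ImpulseGame n p q l) (a₁ : GameControl G.A G.U)
    (a₂ : GameControl G.B G.V) (y : ℝ≥0 → EuclideanSpace ℝ (Fin n)) (t : ℝ≥0) :
    EuclideanSpace ℝ (Fin n) :=
  open Classical in
  (∑' m, if a₁.imp.time m < t ∧ ∀ k, a₁.imp.time m ≠ a₂.imp.time k then
      impulseJump G.gξ (stateBefore G.gξ a₁.imp y m) (a₁.imp.act m) else 0)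
    + ∑' k, if a₂.imp.time k < t then
      impulseJump G.gη (stateBefore G.gη a₂.imp y k) (a₂.imp.act k) else 0

/-- `y` solves the state equation on `[0, T]`. -/
def IsTrajectoryOn (G : ImpulseGame n p q l) (x : EuclideanSpace ℝ (Fin n))
    (a₁ : GameControl G.A G.U) (a₂ : GameControl G.B G.V) (T : ℝ≥0)
    (y : ℝ≥0 → EuclideanSpace ℝ (Fin n)) : Prop :=
  ∀ t ≤ T, IntervalIntegrable (G.drift a₁ a₂ y) volume 0 t ∧
    y t = x + (∫ s in (0 : ℝ)..t, G.drift a₁ a₂ y s) + G.jumps a₁ a₂ y t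

theorem isTrajectory_iff : G.IsTrajectory x a₁ a₂ y ↔ ∀ T, G.IsTrajectoryOn x a₁ a₂ T y := by
  simp only [IsTrajectory, IsTrajectoryOn, jumps, ← add_assoc]
  exact ⟨fun h T t _ => h t, fun h t => h t t le_rfl⟩

theorem IsTrajectoryOn.mono {S T : ℝ≥0} (h : G.IsTrajectoryOn x a₁ a₂ T y) (hST : S ≤ T) :
    G.IsTrajectoryOn x a₁ a₂ S y := fun t ht => h t (ht.trans hST)

theorem drift_eqOn {S : ℝ≥0} (h : ∀ s ≤ S, y s = y' s) {t : ℝ≥0} (ht : t ≤ S) :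
    Set.EqOn (G.drift a₁ a₂ y) (G.drift a₁ a₂ y') (Set.uIoc (0 : ℝ) t) := fun r hr => by
  rw [Set.uIoc_of_le t.coe_nonneg] at hr
  rw [drift, drift, h _ ((Real.toNNReal_le_iff_le_coe.2 hr.2).trans ht)]

theorem jumps_congr {T : ℝ≥0} (h : ∀ s ∈ a₁.imp.times ∪ a₂.imp.times, s < T → y s = y' s) :
    G.jumps a₁ a₂ y T = G.jumps a₁ a₂ y' T := by
  classical
  rw [jumps, jumps]
  congr 1
  · refine tsum_congr fun m => ?_
    split_ifs with hm
    · obtain ⟨h1, h2⟩ := a₁.imp.toNNReal_mem_times hm.1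
      rw [a₁.imp.stateBefore_congr G.gξ m (h _ (Or.inl h1) h2)]
    · rfl
  · refine tsum_congr fun m => ?_
    split_ifs with hm
    · obtain ⟨h1, h2⟩ := a₂.imp.toNNReal_mem_times hm
      rw [a₂.imp.stateBefore_congr G.gη m (h _ (Or.inr h1) h2)]
    · rfl

/-- An impulse before `T` happens at or before `s`, hence before `t`. On `(s, T]` the jump term is
therefore constant, and the state equation there is an ordinary differential equation. -/
theorem jumps_eq_of_gap {s t T : ℝ≥0} (hst : s < t) (htT : t ≤ T)
    (hgap : (a₁.imp.times ∪ a₂.imp.times) ∩ Set.Ioo s T = ∅) :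
    G.jumps a₁ a₂ y t = G.jumps a₁ a₂ y T := by
  have key : ∀ r : ℝ≥0∞, (∀ r' : ℝ≥0, r = r' → r' ∈ a₁.imp.times ∪ a₂.imp.times) →
      (r < t ↔ r < T) := by
    intro r hr
    refine ⟨fun h => h.trans_le (by exact_mod_cast htT), fun h => ?_⟩
    lift r to ℝ≥0 using (h.trans_le le_top).ne
    have h1 := hr r rfl
    have h2 : r < T := by exact_mod_cast h
    have h3 : r ≤ s := by
      by_contra hrs
      exact Set.notMem_empty r (hgap ▸ ⟨h1, not_le.1 hrs, h2⟩)
    exact_mod_cast h3.trans_lt hst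
  have k1 : ∀ m, (a₁.imp.time m < t ↔ a₁.imp.time m < T) := fun m =>
    key _ fun r hr => Or.inl ⟨m, hr⟩
  have k2 : ∀ m, (a₂.imp.time m < t ↔ a₂.imp.time m < T) := fun m =>
    key _ fun r hr => Or.inr ⟨m, hr⟩
  classical
  rw [jumps, jumps]
  congr 1
  · exact tsum_congr fun m => if_congr (and_congr_left' (k1 m)) rfl rfl
  · exact tsum_congr fun m => if_congr (k2 m) rfl rfl

theorem jumps_zero : G.jumps a₁ a₂ y 0 = 0 := by simp [jumps]

theorem finite_times_inter_Iio (a₁ : GameControl G.A G.U) (a₂ : GameControl G.B G.V) (T : ℝ≥0) :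
    ((a₁.imp.times ∪ a₂.imp.times) ∩ Set.Iio T).Finite := by
  rw [Set.union_inter_distrib_right]
  exact (a₁.imp.finite_times_inter_Iio T).union (a₂.imp.finite_times_inter_Iio T)

/-- The velocity as a function of time and state. -/
def velocity (G : ImpulseGame n p q l) (a₁ : GameControl G.A G.U) (a₂ : GameControl G.B G.V)
    (r : ℝ) (v : EuclideanSpace ℝ (Fin n)) : EuclideanSpace ℝ (Fin n) :=
  G.b v (a₁.cont r.toNNReal) (a₂.cont r.toNNReal)

theorem measurable_comp_controls {F : Type*} [TopologicalSpace F] [MeasurableSpace F]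
    [BorelSpace F] {h : EuclideanSpace ℝ (Fin n) → G.A → G.B → F}
    (hh : Continuous fun z : EuclideanSpace ℝ (Fin n) × G.A × G.B => h z.1 z.2.1 z.2.2)
    (a₁ : GameControl G.A G.U) (a₂ : GameControl G.B G.V)
    {φ : ℝ → EuclideanSpace ℝ (Fin n)} (hφ : Measurable φ) :
    Measurable fun r : ℝ => h (φ r) (a₁.cont r.toNNReal) (a₂.cont r.toNNReal) :=
  hh.measurable.comp (hφ.prodMk ((a₁.measurable_cont.comp measurable_real_toNNReal).prodMk
    (a₂.measurable_cont.comp measurable_real_toNNReal)))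

theorem exists_isTrajectoryOn (hb : G.HypDynamics) (x : EuclideanSpace ℝ (Fin n))
    (a₁ : GameControl G.A G.U) (a₂ : GameControl G.B G.V) (T : ℝ≥0) :
    ∃ y, G.IsTrajectoryOn x a₁ a₂ T y := by
  classical
  refine NNReal.induction_on_gaps (finite_times_inter_Iio a₁ a₂) (P := fun T =>
    ∃ y, G.IsTrajectoryOn x a₁ a₂ T y) ⟨fun _ => x, fun t ht => ?_⟩ (fun s T hsT hgap => ?_) T
  · obtain rfl : t = 0 := le_antisymm ht (zero_le)
    simp [jumps_zero]
  rintro ⟨y, hy⟩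
  obtain ⟨C, hC, hlip⟩ := hb.lipschitz
  obtain ⟨M, hM⟩ := hb.bounded
  -- The equation restarts from the state just after the impulses at `s`. Since `jumps` counts
  -- strictly earlier times, these are included in its value at `T`, not in its value at `s`.
  obtain ⟨φ, hφc, hφ⟩ := exists_solution_integral_equation (F := G.velocity a₁ a₂) hC
    (fun t x y => hlip x y _ _) (fun t x => hM x _ _)
    (fun φ hφ => (measurable_comp_controls hb.continuous a₁ a₂
      hφ.measurable).aestronglyMeasurable) s
    (x + (∫ r in (0 : ℝ)..s, G.drift a₁ a₂ y r) + G.jumps a₁ a₂ y T)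
  set y' : ℝ≥0 → EuclideanSpace ℝ (Fin n) := fun t => if t ≤ s then y t else φ t with hy'
  have hle : ∀ r ≤ s, y' r = y r := fun r hr => if_pos hr
  have hjump : G.jumps a₁ a₂ y' T = G.jumps a₁ a₂ y T := jumps_congr fun r hr hrT => by
    refine hle r ?_
    by_contra hrs
    exact Set.notMem_empty r (hgap ▸ ⟨hr, not_le.1 hrs, hrT⟩)
  refine ⟨y', fun t htT => ?_⟩
  rcases le_or_gt t s with hts | hst
  · have he := drift_eqOn (G := G) (a₁ := a₁) (a₂ := a₂) hle hts
    refine ⟨(intervalIntegrable_congr he).2 (hy t hts).1, ?_⟩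
    rw [hle t hts, intervalIntegral.integral_congr_ae (ae_of_all _ he),
      jumps_congr fun r _ hr => hle r (hr.le.trans hts)]
    exact (hy t hts).2
  · have hst' : (s : ℝ) ≤ t := by exact_mod_cast hst.le
    have he := drift_eqOn (G := G) (a₁ := a₁) (a₂ := a₂) hle le_rfl
    have he' : Set.EqOn (G.drift a₁ a₂ y') (fun r => G.velocity a₁ a₂ r (φ r))
        (Set.uIoc (s : ℝ) t) := fun r hr => by
      rw [Set.uIoc_of_le hst'] at hr
      have hr0 : (0 : ℝ) ≤ r := s.2.trans hr.1.le
      have h1 : y' r.toNNReal = φ r := by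
        rw [hy']
        simp only
        rw [if_neg, Real.coe_toNNReal _ hr0]
        rw [not_le, ← NNReal.coe_lt_coe, Real.coe_toNNReal _ hr0]
        exact hr.1
      simp only [drift, velocity, h1]
    have hi1 : IntervalIntegrable (G.drift a₁ a₂ y') volume 0 s :=
      (intervalIntegrable_congr he).2 (hy s le_rfl).1
    have hi2 : IntervalIntegrable (G.drift a₁ a₂ y') volume s t :=
      (intervalIntegrable_congr he').2 (intervalIntegrable_of_norm_le
        (measurable_comp_controls hb.continuous a₁ a₂ hφc.measurable).aestronglyMeasurable
        (fun t => hM _ _ _) _ _)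
    refine ⟨hi1.trans hi2, ?_⟩
    rw [← intervalIntegral.integral_add_adjacent_intervals hi1 hi2,
      intervalIntegral.integral_congr_ae (ae_of_all _ he),
      intervalIntegral.integral_congr_ae (ae_of_all _ he'), jumps_eq_of_gap hst htT hgap, hjump]
    have h1 : y' t = φ t := if_neg (not_le.2 hst)
    rw [h1, hφ t hst']
    abel

theorem IsTrajectoryOn.eq (hb : G.HypDynamics) {T : ℝ≥0} (hy : G.IsTrajectoryOn x a₁ a₂ T y)
    (hy' : G.IsTrajectoryOn x a₁ a₂ T y') : ∀ t ≤ T, y t = y' t := by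
  revert hy hy'
  refine NNReal.induction_on_gaps (finite_times_inter_Iio a₁ a₂) (P := fun T =>
    G.IsTrajectoryOn x a₁ a₂ T y → G.IsTrajectoryOn x a₁ a₂ T y' → ∀ t ≤ T, y t = y' t)
    (fun hy hy' t ht => ?_) (fun s T hsT hgap ih hy hy' t ht => ?_) T
  · obtain rfl : t = 0 := le_antisymm ht (zero_le)
    rw [(hy 0 le_rfl).2, (hy' 0 le_rfl).2]
    simp [jumps_zero]
  have hs := ih (hy.mono hsT.le) (hy'.mono hsT.le)
  rcases le_or_gt t s with hts | hst
  · exact hs t hts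
  obtain ⟨C, hC, hlip⟩ := hb.lipschitz
  have hjump : G.jumps a₁ a₂ y' T = G.jumps a₁ a₂ y T := jumps_congr fun r hr hrT => by
    refine (hs r ?_).symm
    by_contra hrs
    exact Set.notMem_empty r (hgap ▸ ⟨hr, not_le.1 hrs, hrT⟩)
  have hint : ∫ r in (0 : ℝ)..s, G.drift a₁ a₂ y' r = ∫ r in (0 : ℝ)..s, G.drift a₁ a₂ y r :=
    (intervalIntegral.integral_congr_ae (ae_of_all _ (drift_eqOn hs le_rfl))).symm
  have hsT' : (s : ℝ) ≤ T := by exact_mod_cast hsT.le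
  -- The half-open interval is essential: at `s` the left-continuous trajectory has not yet made the
  -- jumps that the initial value on the right contains.
  have aux : ∀ w, G.IsTrajectoryOn x a₁ a₂ T w → IntervalIntegrable (G.drift a₁ a₂ w) volume s T ∧
      ∀ r ∈ Set.Ioc (s : ℝ) T, w r.toNNReal = x + (∫ r in (0 : ℝ)..s, G.drift a₁ a₂ w r)
        + G.jumps a₁ a₂ w T + ∫ r in (s : ℝ)..r, G.drift a₁ a₂ w r := by
    intro w hw
    have hi := ((hw s hsT.le).1.symm.trans (hw T le_rfl).1)
    refine ⟨hi, fun r hr => ?_⟩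
    lift r to ℝ≥0 using s.2.trans hr.1.le
    have hrT : r ≤ T := by exact_mod_cast hr.2
    rw [Real.toNNReal_coe, (hw r hrT).2, jumps_eq_of_gap (by exact_mod_cast hr.1) hrT hgap,
      ← intervalIntegral.integral_add_adjacent_intervals (hw s hsT.le).1
        ((hw s hsT.le).1.symm.trans (hw r hrT).1)]
    abel
  obtain ⟨hi, he⟩ := aux y hy
  obtain ⟨hi', he'⟩ := aux y' hy'
  rw [hjump, hint] at he'
  have := eq_of_integral_equation (F := G.velocity a₁ a₂) hC (fun t x y => hlip x y _ _)
    (φ := fun r => y r.toNNReal) (ψ := fun r => y' r.toNNReal) hi hi' he he' t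
    ⟨by exact_mod_cast hst, by exact_mod_cast ht⟩
  simpa using this

theorem isTrajectory_trajectory (hb : G.HypDynamics) (x : EuclideanSpace ℝ (Fin n))
    (a₁ : GameControl G.A G.U) (a₂ : GameControl G.B G.V) :
    G.IsTrajectory x a₁ a₂ (G.trajectory x a₁ a₂) := by
  have h : ∃ y, G.IsTrajectory x a₁ a₂ y := by
    choose Y hY using exists_isTrajectoryOn hb x a₁ a₂
    -- By uniqueness the solutions on the intervals `[0, T]` are compatible, so their diagonal is a
    -- global solution.
    refine ⟨fun t => Y t t, isTrajectory_iff.2 fun T t ht => ?_⟩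
    have he : ∀ s ≤ t, Y s s = Y t s := fun s hs => (hY s).eq hb ((hY t).mono hs) s le_rfl
    refine ⟨(intervalIntegrable_congr (drift_eqOn he le_rfl)).2 (hY t t le_rfl).1, ?_⟩
    rw [intervalIntegral.integral_congr_ae (ae_of_all _ (drift_eqOn he le_rfl)),
      jumps_congr fun r _ hr => he r hr.le]
    exact (hY t t le_rfl).2
  rw [trajectory, dif_pos h]
  exact h.choose_spec

theorem IsTrajectoryOn.eq_trajectory (hb : G.HypDynamics) {T : ℝ≥0}
    (hy : G.IsTrajectoryOn x a₁ a₂ T y) : ∀ t ≤ T, y t = G.trajectory x a₁ a₂ t :=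
  hy.eq hb (isTrajectory_iff.1 (isTrajectory_trajectory hb x a₁ a₂) T)

end ImpulseGame

/-! ### Cutting and gluing controls at a time -/

namespace ImpulseControl

variable {n N : ℕ} {U : ConvexCone ℝ (EuclideanSpace ℝ (Fin N))}

/-- The number of impulses before `T`. -/
noncomputable def countBefore (T : ℝ≥0) (u : ImpulseControl U) : ℕ := sInf {m | T ≤ u.time m}

/-- Monotonicity makes the impulses before `T` an initial segment of the indices. Convergence to `⊤`
makes the set under `sInf` non-empty, so no default value enters. -/
theorem lt_countBefore_iff {T : ℝ≥0} {u : ImpulseControl U} {m : ℕ} :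
    m < u.countBefore T ↔ u.time m < T := by
  refine ⟨fun h => not_le.1 (Nat.notMem_of_lt_sInf (s := {m | (T : ℝ≥0∞) ≤ u.time m}) h),
    fun h => ?_⟩
  by_contra hm
  obtain ⟨k, hk⟩ := (u.tendsto_time.eventually
    (lt_mem_nhds (ENNReal.coe_lt_top (r := T)))).exists
  have h1 : (T : ℝ≥0∞) ≤ u.time (u.countBefore T) :=
    Nat.sInf_mem (s := {m | (T : ℝ≥0∞) ≤ u.time m}) ⟨k, hk.le⟩
  exact (h1.trans (u.monotone_time (not_lt.1 hm))).not_gt h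

theorem le_time_add_countBefore (T : ℝ≥0) (u : ImpulseControl U) (m : ℕ) :
    (T : ℝ≥0∞) ≤ u.time (m + u.countBefore T) :=
  not_lt.1 fun h => by have := lt_countBefore_iff.2 h; omega

/-- The impulses from time `T` on, with time measured from `T`. -/
noncomputable def shift (T : ℝ≥0) (u : ImpulseControl U) : ImpulseControl U where
  time m := u.time (m + u.countBefore T) - T
  act m := u.act (m + u.countBefore T)
  monotone_time _ _ h := tsub_le_tsub_right (u.monotone_time (by omega)) _
  tendsto_time := by
    rw [ENNReal.tendsto_nhds_top_iff_nnreal]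
    intro r
    have h := ((tendsto_add_atTop_iff_nat (u.countBefore T)).2 u.tendsto_time).eventually
      (lt_mem_nhds (ENNReal.coe_lt_top (r := T + r)))
    filter_upwards [h] with m hm
    rw [lt_tsub_iff_left]
    exact_mod_cast hm

theorem add_shift_time (T : ℝ≥0) (u : ImpulseControl U) (m : ℕ) :
    T + (u.shift T).time m = u.time (m + u.countBefore T) :=
  add_tsub_cancel_of_le (u.le_time_add_countBefore T m)

theorem shift_time_lt_iff {T : ℝ≥0} {u : ImpulseControl U} {m : ℕ} {t : ℝ≥0∞} :
    u.time (m + u.countBefore T) < t + T ↔ (u.shift T).time m < t := by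
  rw [← add_shift_time, add_comm t, ENNReal.add_lt_add_iff_left ENNReal.coe_ne_top]

theorem shift_time_le_iff {T : ℝ≥0} {u : ImpulseControl U} {m : ℕ} {t : ℝ≥0∞} :
    u.time (m + u.countBefore T) ≤ T + t ↔ (u.shift T).time m ≤ t := by
  rw [← add_shift_time, ENNReal.add_le_add_iff_left ENNReal.coe_ne_top]

/-- Impulses before `T` and impulses from `T` on never share a time, so the cut does not break up a
group of simultaneous impulses. -/
theorem stateBefore_countBefore
    (g : EuclideanSpace ℝ (Fin n) → EuclideanSpace ℝ (Fin N) → EuclideanSpace ℝ (Fin n))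
    (T : ℝ≥0) (u : ImpulseControl U) (y : ℝ≥0 → EuclideanSpace ℝ (Fin n)) :
    stateBefore g u y (u.countBefore T) = y (u.time (u.countBefore T)).toNNReal := by
  rcases h : u.countBefore T with _ | k
  · rfl
  · rw [stateBefore, if_neg]
    intro he
    have h1 := lt_countBefore_iff.1 (h ▸ Nat.lt_succ_self k : k < u.countBefore T)
    have h2 := u.le_time_add_countBefore T 0
    rw [zero_add, h, he] at h2
    exact h2.not_gt h1

/-- Finiteness of the time matters: `toNNReal` sends `⊤` to `0`, which does not commute with the
translation by `T`. -/
theorem stateBefore_shift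
    (g : EuclideanSpace ℝ (Fin n) → EuclideanSpace ℝ (Fin N) → EuclideanSpace ℝ (Fin n))
    (T : ℝ≥0) (u : ImpulseControl U) (y : ℝ≥0 → EuclideanSpace ℝ (Fin n)) {m : ℕ}
    (hm : (u.shift T).time m < ⊤) :
    stateBefore g (u.shift T) (fun t => y (t + T)) m
      = stateBefore g u y (m + u.countBefore T) := by
  have key : ∀ k, (u.shift T).time k < ⊤ →
      ((u.shift T).time k).toNNReal + T = (u.time (k + u.countBefore T)).toNNReal := by
    intro k hk
    rw [← add_shift_time, add_comm, ENNReal.toNNReal_add ENNReal.coe_ne_top hk.ne,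
      ENNReal.toNNReal_coe]
  induction m with
  | zero =>
    have := key 0 hm
    rw [stateBefore, this, zero_add, stateBefore_countBefore]
  | succ m ih =>
    have hm' : (u.shift T).time m < ⊤ :=
      ((u.shift T).monotone_time (Nat.le_succ m)).trans_lt hm
    have hk := key (m + 1) hm
    have hiff : (u.shift T).time (m + 1) = (u.shift T).time m ↔
        u.time (m + u.countBefore T + 1) = u.time (m + u.countBefore T) := by
      rw [← add_shift_time T u m, add_right_comm m, ← add_shift_time T u (m + 1),
        ENNReal.add_right_inj ENNReal.coe_ne_top]
    rw [add_right_comm, stateBefore, stateBefore, ih hm', hk, add_right_comm]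
    exact if_congr hiff rfl rfl

/-- Follow `u` before `T`, and `u'` (with time measured from `T`) from `T` on. -/
noncomputable def concat (T : ℝ≥0) (u u' : ImpulseControl U) : ImpulseControl U where
  time m := if m < u.countBefore T then u.time m else T + u'.time (m - u.countBefore T)
  act m := if m < u.countBefore T then u.act m else u'.act (m - u.countBefore T)
  monotone_time i j h := by
    simp only
    split_ifs with h1 h2
    · exact u.monotone_time h
    · exact (lt_countBefore_iff.1 h1).le.trans le_self_add
    · omega
    · gcongr
      exact u'.monotone_time (by omega)
  tendsto_time := by
    rw [ENNReal.tendsto_nhds_top_iff_nnreal]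
    intro r
    have h := (u'.tendsto_time.comp (tendsto_sub_atTop_nat (u.countBefore T))).eventually
      (lt_mem_nhds (ENNReal.coe_lt_top (r := r)))
    filter_upwards [h, eventually_ge_atTop (u.countBefore T)] with m hm hm'
    rw [if_neg (by omega)]
    exact lt_of_lt_of_le hm le_add_self

theorem concat_time_of_lt {T : ℝ≥0} {u u' : ImpulseControl U} {m : ℕ}
    (h : m < u.countBefore T) : (u.concat T u').time m = u.time m := if_pos h

theorem concat_act_of_lt {T : ℝ≥0} {u u' : ImpulseControl U} {m : ℕ}
    (h : m < u.countBefore T) : (u.concat T u').act m = u.act m := if_pos h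

theorem concat_time_add (T : ℝ≥0) (u u' : ImpulseControl U) (m : ℕ) :
    (u.concat T u').time (m + u.countBefore T) = T + u'.time m := by simp [concat]

theorem concat_act_add (T : ℝ≥0) (u u' : ImpulseControl U) (m : ℕ) :
    (u.concat T u').act (m + u.countBefore T) = u'.act m := by simp [concat]

theorem concat_time_lt_iff {T : ℝ≥0} {u u' : ImpulseControl U} {m : ℕ} :
    (u.concat T u').time m < T ↔ m < u.countBefore T := by
  refine ⟨fun h => ?_, fun h => by rw [concat_time_of_lt h]; exact lt_countBefore_iff.1 h⟩
  by_contra hm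
  obtain ⟨k, rfl⟩ := Nat.exists_eq_add_of_le' (not_lt.1 hm)
  rw [concat_time_add] at h
  exact le_self_add.not_gt h

theorem countBefore_concat (T : ℝ≥0) (u u' : ImpulseControl U) :
    (u.concat T u').countBefore T = u.countBefore T := by
  refine eq_of_forall_lt_iff fun m => ?_
  rw [lt_countBefore_iff, concat_time_lt_iff]

@[ext]
theorem ext' {u u' : ImpulseControl U} (h : ∀ m, u.time m = u'.time m)
    (h' : ∀ m, u.act m = u'.act m) : u = u' := by
  cases u; cases u'
  congr
  · exact funext h
  · exact funext h'

theorem shift_concat (T : ℝ≥0) (u u' : ImpulseControl U) : (u.concat T u').shift T = u' := by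
  ext1 m
  · simp only [shift]
    rw [countBefore_concat, concat_time_add, ENNReal.add_sub_cancel_left ENNReal.coe_ne_top]
  · simp only [shift]
    rw [countBefore_concat, concat_act_add]

/-- Splitting a series over the impulses at time `T`. -/
theorem tsum_eq_tsum_add_tsum_shift {M : Type*} [AddCommMonoid M] [TopologicalSpace M] [T2Space M]
    [ContinuousAdd M] (T : ℝ≥0) (u : ImpulseControl U) {h h₀ h₁ : ℕ → M}
    (e₀ : ∀ m, u.time m < T → h m = h₀ m) (e₀' : ∀ m, ¬ u.time m < T → h₀ m = 0)
    (e₁ : ∀ m, h (m + u.countBefore T) = h₁ m) (hs : Summable h₁) :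
    ∑' m, h m = ∑' m, h₀ m + ∑' m, h₁ m := by
  have h1 : ∑' m, h₀ m = ∑ m ∈ Finset.range (u.countBefore T), h m := by
    rw [tsum_eq_sum (s := Finset.range (u.countBefore T)) fun m hm =>
      e₀' m (by rwa [Finset.mem_range, lt_countBefore_iff] at hm)]
    exact Finset.sum_congr rfl fun m hm =>
      (e₀ m (lt_countBefore_iff.1 (Finset.mem_range.1 hm))).symm
  have h2 : (fun m => h (m + u.countBefore T)) = h₁ := funext e₁
  rw [h1, ← h2, Summable.sum_add_tsum_nat_add' (by rwa [h2])]

/-- An impulse of `v` that coincides with one of `u` from `T` on is itself not before `T`, so the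
shift keeps it. -/
theorem forall_time_ne_shift_iff {N' : ℕ} {V : ConvexCone ℝ (EuclideanSpace ℝ (Fin N'))}
    (T : ℝ≥0) (u : ImpulseControl U) (v : ImpulseControl V) (m : ℕ) :
    (∀ k, u.time (m + u.countBefore T) ≠ v.time k) ↔
      ∀ k, (u.shift T).time m ≠ (v.shift T).time k := by
  refine ⟨fun h k he => h (k + v.countBefore T) ?_, fun h k he => ?_⟩
  · rw [← add_shift_time, ← add_shift_time, he]
  · have hk : ¬ k < v.countBefore T := by
      rw [lt_countBefore_iff, ← he, not_lt]
      exact le_time_add_countBefore T u m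
    obtain ⟨j, rfl⟩ := Nat.exists_eq_add_of_le' (not_lt.1 hk)
    rw [← add_shift_time, ← add_shift_time, ENNReal.add_right_inj ENNReal.coe_ne_top] at he
    exact h j he

end ImpulseControl

namespace GameControl

open ImpulseControl

variable {l N : ℕ} {A : Set (EuclideanSpace ℝ (Fin l))}
  {U : ConvexCone ℝ (EuclideanSpace ℝ (Fin N))} {T : ℝ≥0} {a a' a'' : GameControl A U}

/-- The control from time `T` on, with time measured from `T`. -/
noncomputable def shift (T : ℝ≥0) (a : GameControl A U) : GameControl A U where
  cont s := a.cont (s + T)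
  measurable_cont := a.measurable_cont.comp (by fun_prop)
  imp := a.imp.shift T

/-- Follow `a` before `T`, and `a'` (with time measured from `T`) from `T` on. -/
noncomputable def concat (T : ℝ≥0) (a a' : GameControl A U) : GameControl A U where
  cont s := if s < T then a.cont s else a'.cont (s - T)
  measurable_cont := Measurable.ite measurableSet_Iio a.measurable_cont
    (a'.measurable_cont.comp (by fun_prop))
  imp := a.imp.concat T a'.imp

/-- Two controls agree on `[0, T)`. -/
def AgreeBefore (T : ℝ≥0) (a a' : GameControl A U) : Prop :=
  (∀ s < T, a.cont s = a'.cont s) ∧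
    ∀ m, (a.imp.time m < T ∨ a'.imp.time m < T) →
      a.imp.time m = a'.imp.time m ∧ a.imp.act m = a'.imp.act m

theorem AgreeBefore.symm (h : a.AgreeBefore T a') : a'.AgreeBefore T a :=
  ⟨fun s hs => (h.1 s hs).symm, fun m hm => ⟨(h.2 m hm.symm).1.symm, (h.2 m hm.symm).2.symm⟩⟩

theorem AgreeBefore.trans (h : a.AgreeBefore T a') (h' : a'.AgreeBefore T a'') :
    a.AgreeBefore T a'' := by
  refine ⟨fun s hs => (h.1 s hs).trans (h'.1 s hs), fun m hm => ?_⟩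
  rcases hm with hm | hm
  · have h1 := h.2 m (Or.inl hm)
    have h2 := h'.2 m (Or.inl (h1.1 ▸ hm))
    exact ⟨h1.1.trans h2.1, h1.2.trans h2.2⟩
  · have h2 := h'.2 m (Or.inr hm)
    have h1 := h.2 m (Or.inr (h2.1 ▸ hm))
    exact ⟨h1.1.trans h2.1, h1.2.trans h2.2⟩

theorem AgreeBefore.agreeUpTo (h : a.AgreeBefore T a') {t : ℝ≥0} (ht : t < T) :
    a.AgreeUpTo t a' :=
  ⟨fun s hs => h.1 s (hs.trans_lt ht), fun m hm => h.2 m (by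
    have ht' : (t : ℝ≥0∞) < T := by exact_mod_cast ht
    exact hm.imp (fun h => h.trans_lt ht') fun h => h.trans_lt ht')⟩

/-- An impulse before `T` has a finite time `r < T`, and agreement up to `r` already detects it. -/
theorem agreeBefore_of_forall_agreeUpTo (h : ∀ t < T, a.AgreeUpTo t a') : a.AgreeBefore T a' := by
  refine ⟨fun s hs => (h s hs).1 s le_rfl, fun m hm => ?_⟩
  rcases hm with hm | hm
  · obtain ⟨r, hr⟩ := WithTop.ne_top_iff_exists.1 (hm.trans_le le_top).ne
    change (r : ℝ≥0∞) = _ at hr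
    exact (h r (by rw [← hr] at hm; exact_mod_cast hm)).2 m (Or.inl hr.ge)
  · obtain ⟨r, hr⟩ := WithTop.ne_top_iff_exists.1 (hm.trans_le le_top).ne
    change (r : ℝ≥0∞) = _ at hr
    exact (h r (by rw [← hr] at hm; exact_mod_cast hm)).2 m (Or.inr hr.ge)

theorem AgreeUpTo.mono {s t : ℝ≥0} (h : a.AgreeUpTo t a') (hst : s ≤ t) : a.AgreeUpTo s a' :=
  ⟨fun r hr => h.1 r (hr.trans hst), fun m hm => h.2 m (by
    have hst' : (s : ℝ≥0∞) ≤ t := by exact_mod_cast hst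
    exact hm.imp (fun h => h.trans hst') fun h => h.trans hst')⟩

theorem AgreeBefore.countBefore_eq (h : a.AgreeBefore T a') :
    a.imp.countBefore T = a'.imp.countBefore T := by
  refine eq_of_forall_lt_iff fun m => ?_
  rw [lt_countBefore_iff, lt_countBefore_iff]
  exact ⟨fun hm => (h.2 m (Or.inl hm)).1 ▸ hm, fun hm => (h.2 m (Or.inr hm)).1 ▸ hm⟩

theorem concat_agreeBefore (T : ℝ≥0) (a a' : GameControl A U) :
    (a.concat T a').AgreeBefore T a := by
  refine ⟨fun s hs => if_pos hs, fun m hm => ?_⟩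
  have hm' : m < a.imp.countBefore T :=
    hm.elim (fun h => concat_time_lt_iff.1 h) fun h => lt_countBefore_iff.2 h
  exact ⟨concat_time_of_lt hm', concat_act_of_lt hm'⟩

theorem shift_concat (T : ℝ≥0) (a a' : GameControl A U) : (a.concat T a').shift T = a' := by
  cases a' with
  | mk c hc u =>
    simp only [shift, concat, ImpulseControl.shift_concat, mk.injEq, and_true]
    funext s
    simp

/-- Separates past from future. Agreement before `T` forces equal `countBefore`, so both shifts drop
the same number of impulses and the comparison index by index survives. -/
theorem agreeUpTo_add_iff {t : ℝ≥0} :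
    a.AgreeUpTo (T + t) a' ↔ a.AgreeBefore T a' ∧ (a.shift T).AgreeUpTo t (a'.shift T) := by
  have hiff : ∀ (c : GameControl A U) (m : ℕ),
      c.imp.time (m + c.imp.countBefore T) ≤ (T + t : ℝ≥0) ↔ (c.imp.shift T).time m ≤ t :=
    fun c m => by rw [ENNReal.coe_add]; exact shift_time_le_iff
  constructor
  · intro h
    have hb : a.AgreeBefore T a' := agreeBefore_of_forall_agreeUpTo fun s hs =>
      h.mono (hs.le.trans le_self_add)
    have hN := hb.countBefore_eq
    refine ⟨hb, fun s hs => h.1 _ ?_, fun m hm => ?_⟩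
    · rw [add_comm]; gcongr
    · have := h.2 (m + a.imp.countBefore T) (hm.imp (fun h => (hiff a m).2 h) fun h => by
        rw [hN]; exact (hiff a' m).2 h)
      simp only [shift, ImpulseControl.shift, ← hN]
      exact ⟨by rw [this.1], this.2⟩
  · rintro ⟨hb, hs⟩
    have hN := hb.countBefore_eq
    refine ⟨fun s hs' => ?_, fun m hm => ?_⟩
    · rcases lt_or_ge s T with h | h
      · exact hb.1 s h
      · obtain ⟨r, rfl⟩ := exists_add_of_le h
        rw [add_comm]
        exact hs.1 r (le_of_add_le_add_left hs')
    · rcases lt_or_ge m (a.imp.countBefore T) with h | h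
      · exact hb.2 m (Or.inl (lt_countBefore_iff.1 h))
      · obtain ⟨k, rfl⟩ := Nat.exists_eq_add_of_le' h
        have := hs.2 k (hm.imp (fun h => (hiff a k).1 h) fun h => (hiff a' k).1 (by rwa [← hN]))
        refine ⟨?_, ?_⟩
        · rw [← add_shift_time, hN, ← add_shift_time]
          exact congrArg _ this.1
        · have := this.2
          simp only [shift, ImpulseControl.shift, ← hN] at this
          exact this

theorem AgreeBefore.stateBefore_eq {n : ℕ}
    (g : EuclideanSpace ℝ (Fin n) → EuclideanSpace ℝ (Fin N) → EuclideanSpace ℝ (Fin n))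
    (h : a.AgreeBefore T a') (y : ℝ≥0 → EuclideanSpace ℝ (Fin n)) {m : ℕ}
    (hm : a.imp.time m < T) : stateBefore g a.imp y m = stateBefore g a'.imp y m := by
  induction m with
  | zero => rw [stateBefore, stateBefore, (h.2 0 (Or.inl hm)).1]
  | succ m ih =>
    have hm' := (a.imp.monotone_time (Nat.le_succ m)).trans_lt hm
    rw [stateBefore, stateBefore, (h.2 _ (Or.inl hm)).1, (h.2 _ (Or.inl hm')).1,
      (h.2 _ (Or.inl hm')).2, ih hm']

end GameControl

/-- The strategy that always answers by the same control is non-anticipative. -/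
theorem nonAnticipative_const {l N N' : ℕ} {A B : Set (EuclideanSpace ℝ (Fin l))}
    {U : ConvexCone ℝ (EuclideanSpace ℝ (Fin N))} {V : ConvexCone ℝ (EuclideanSpace ℝ (Fin N'))}
    (a : GameControl B V) : NonAnticipative fun _ : GameControl A U => a :=
  fun _ _ _ _ => ⟨fun _ _ => rfl, fun _ _ => ⟨rfl, rfl⟩⟩

/-- Non-anticipativity speaks of closed intervals; using it at every `t < T` gives the half-open
version required by the cut. -/
theorem NonAnticipative.agreeBefore {l N N' : ℕ} {A B : Set (EuclideanSpace ℝ (Fin l))}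
    {U : ConvexCone ℝ (EuclideanSpace ℝ (Fin N))} {V : ConvexCone ℝ (EuclideanSpace ℝ (Fin N'))}
    {α : GameControl A U → GameControl B V} (hα : NonAnticipative α) {T : ℝ≥0}
    {a a' : GameControl A U} (h : a.AgreeBefore T a') : (α a).AgreeBefore T (α a') :=
  GameControl.agreeBefore_of_forall_agreeUpTo fun t ht => hα t _ _ (h.agreeUpTo ht)

/-! ### State and payoff at `T` depend only on the controls before `T` -/

namespace ImpulseGame

open ImpulseControl GameControl

variable {n p q l : ℕ} {G : ImpulseGame n p q l} {x : EuclideanSpace ℝ (Fin n)}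
  {a₁ a₁' : GameControl G.A G.U} {a₂ a₂' : GameControl G.B G.V} {T : ℝ≥0}
  {y y' : ℝ≥0 → EuclideanSpace ℝ (Fin n)}

section Agreement

/-- The impulse that would cancel another one happens at the same time, hence also before `T`, where
the controls agree. -/
theorem effective_of_agreeBefore (h₁ : a₁.AgreeBefore T a₁') (h₂ : a₂.AgreeBefore T a₂')
    {S : ℝ≥0∞} (hS : S ≤ T) {m : ℕ}
    (hm : a₁.imp.time m < S ∧ ∀ k, a₁.imp.time m ≠ a₂.imp.time k) :
    a₁'.imp.time m < S ∧ ∀ k, a₁'.imp.time m ≠ a₂'.imp.time k := by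
  have h := (h₁.2 m (Or.inl (hm.1.trans_le hS))).1
  rw [← h]
  refine ⟨hm.1, fun k hk => hm.2 k ?_⟩
  rw [hk, (h₂.2 k (Or.inr (hk ▸ hm.1.trans_le hS))).1]

theorem effective_iff (h₁ : a₁.AgreeBefore T a₁') (h₂ : a₂.AgreeBefore T a₂')
    {S : ℝ≥0∞} (hS : S ≤ T) (m : ℕ) :
    (a₁.imp.time m < S ∧ ∀ k, a₁.imp.time m ≠ a₂.imp.time k) ↔
      (a₁'.imp.time m < S ∧ ∀ k, a₁'.imp.time m ≠ a₂'.imp.time k) :=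
  ⟨effective_of_agreeBefore h₁ h₂ hS, effective_of_agreeBefore h₁.symm h₂.symm hS⟩

theorem time_lt_iff_of_agreeBefore (h₂ : a₂.AgreeBefore T a₂') {S : ℝ≥0∞} (hS : S ≤ T) (m : ℕ) :
    a₂.imp.time m < S ↔ a₂'.imp.time m < S :=
  ⟨fun h => (h₂.2 m (Or.inl (h.trans_le hS))).1 ▸ h,
    fun h => (h₂.2 m (Or.inr (h.trans_le hS))).1 ▸ h⟩

theorem jumps_eq_of_agreeBefore (h₁ : a₁.AgreeBefore T a₁') (h₂ : a₂.AgreeBefore T a₂')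
    {t : ℝ≥0} (ht : t ≤ T) : G.jumps a₁ a₂ y t = G.jumps a₁' a₂' y t := by
  classical
  have hS : (t : ℝ≥0∞) ≤ T := by exact_mod_cast ht
  rw [jumps, jumps]
  congr 1
  · refine tsum_congr fun m => ?_
    rw [if_congr (effective_iff h₁ h₂ hS m) rfl rfl]
    split_ifs with hm
    · have hm' := ((effective_iff h₁ h₂ hS m).2 hm).1.trans_le hS
      rw [h₁.stateBefore_eq G.gξ y hm', (h₁.2 m (Or.inl hm')).2]
    · rfl
  · refine tsum_congr fun m => ?_
    rw [if_congr (time_lt_iff_of_agreeBefore h₂ hS m) rfl rfl]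
    split_ifs with hm
    · have hm' := ((time_lt_iff_of_agreeBefore h₂ hS m).2 hm).trans_le hS
      rw [h₂.stateBefore_eq G.gη y hm', (h₂.2 m (Or.inl hm')).2]
    · rfl

/-- The controls may differ at `T` itself, hence the open interval, which is enough for integrals.
-/
theorem controls_eqOn_uIoo (h₁ : a₁.AgreeBefore T a₁') (h₂ : a₂.AgreeBefore T a₂')
    {F : Type*} (h : ℝ → G.A → G.B → F) {t : ℝ≥0} (ht : t ≤ T) :
    Set.EqOn (fun r : ℝ => h r (a₁.cont r.toNNReal) (a₂.cont r.toNNReal))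
      (fun r : ℝ => h r (a₁'.cont r.toNNReal) (a₂'.cont r.toNNReal)) (Set.uIoo (0 : ℝ) t) := by
  intro r hr
  rw [Set.uIoo_of_le t.coe_nonneg] at hr
  have hrT : r.toNNReal < T :=
    ((Real.toNNReal_lt_iff_lt_coe hr.1.le).2 hr.2).trans_le ht
  simp only [h₁.1 _ hrT, h₂.1 _ hrT]

theorem IsTrajectoryOn.of_agreeBefore (h₁ : a₁.AgreeBefore T a₁') (h₂ : a₂.AgreeBefore T a₂')
    (hy : G.IsTrajectoryOn x a₁ a₂ T y) : G.IsTrajectoryOn x a₁' a₂' T y := by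
  intro t ht
  have he := controls_eqOn_uIoo h₁ h₂ (fun r θ₁ θ₂ => G.b (y r.toNNReal) θ₁ θ₂) ht
  refine ⟨(intervalIntegrable_congr_uIoo he).1 (hy t ht).1, ?_⟩
  rw [(hy t ht).2, jumps_eq_of_agreeBefore h₁ h₂ ht]
  congr 2
  exact intervalIntegral.integral_congr_uIoo he

theorem trajectory_eq_of_agreeBefore (hb : G.HypDynamics) (h₁ : a₁.AgreeBefore T a₁')
    (h₂ : a₂.AgreeBefore T a₂') {t : ℝ≥0} (ht : t ≤ T) :
    G.trajectory x a₁ a₂ t = G.trajectory x a₁' a₂' t :=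
  ((isTrajectory_iff.1 (isTrajectory_trajectory hb x a₁ a₂) T).of_agreeBefore h₁ h₂).eq_trajectory
    hb t ht

theorem integral_discountedGain_eq_of_agreeBefore (hb : G.HypDynamics)
    (h₁ : a₁.AgreeBefore T a₁') (h₂ : a₂.AgreeBefore T a₂') :
    ∫ t in (0 : ℝ)..T, G.discountedGain x a₁ a₂ t
      = ∫ t in (0 : ℝ)..T, G.discountedGain x a₁' a₂' t := by
  refine intervalIntegral.integral_congr_uIoo fun r hr => ?_
  have := controls_eqOn_uIoo h₁ h₂
    (fun r θ₁ θ₂ => G.f (G.trajectory x a₁ a₂ r.toNNReal) θ₁ θ₂) le_rfl hr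
  simp only at this
  rw [Set.uIoo_of_le T.coe_nonneg] at hr
  rw [discountedGain, discountedGain, this, trajectory_eq_of_agreeBefore hb h₁ h₂
    (Real.toNNReal_le_iff_le_coe.2 hr.2.le)]

theorem costMax_eq_of_agreeBefore (hb : G.HypDynamics)
    (h₁ : a₁.AgreeBefore T a₁') (h₂ : a₂.AgreeBefore T a₂') :
    G.costMax T x a₁ a₂ = G.costMax T x a₁' a₂' := by
  classical
  rw [costMax, costMax]
  refine tsum_congr fun m => ?_
  rw [if_congr (effective_iff h₁ h₂ le_rfl m) rfl rfl]
  split_ifs with hm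
  · have hm' := ((effective_iff h₁ h₂ le_rfl m).2 hm).1
    rw [stateBefore_congr G.gξ a₁.imp m (trajectory_eq_of_agreeBefore hb h₁ h₂
      (a₁.imp.toNNReal_mem_times hm').2.le), h₁.stateBefore_eq G.gξ _ hm',
      (h₁.2 m (Or.inl hm')).1, (h₁.2 m (Or.inl hm')).2]
  · rfl

theorem costMin_eq_of_agreeBefore (hb : G.HypDynamics)
    (h₁ : a₁.AgreeBefore T a₁') (h₂ : a₂.AgreeBefore T a₂') :
    G.costMin T x a₁ a₂ = G.costMin T x a₁' a₂' := by
  classical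
  rw [costMin, costMin]
  refine tsum_congr fun m => ?_
  rw [if_congr (time_lt_iff_of_agreeBefore h₂ le_rfl m) rfl rfl]
  split_ifs with hm
  · have hm' := (time_lt_iff_of_agreeBefore h₂ le_rfl m).2 hm
    rw [stateBefore_congr G.gη a₂.imp m (trajectory_eq_of_agreeBefore hb h₁ h₂
      (a₂.imp.toNNReal_mem_times hm').2.le), h₂.stateBefore_eq G.gη _ hm',
      (h₂.2 m (Or.inl hm')).1, (h₂.2 m (Or.inl hm')).2]
  · rfl

end Agreement

/-! ### Flow property and splitting of the impulse costs -/

section Flow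

theorem effective_shift_iff (T : ℝ≥0) (t : ℝ≥0∞) (m : ℕ) :
    (a₁.imp.time (m + a₁.imp.countBefore T) < t + T ∧
        ∀ k, a₁.imp.time (m + a₁.imp.countBefore T) ≠ a₂.imp.time k) ↔
      ((a₁.shift T).imp.time m < t ∧
        ∀ k, (a₁.shift T).imp.time m ≠ (a₂.shift T).imp.time k) :=
  and_congr shift_time_lt_iff (forall_time_ne_shift_iff T a₁.imp a₂.imp m)

theorem jumps_add (T t : ℝ≥0) (y : ℝ≥0 → EuclideanSpace ℝ (Fin n)) :
    G.jumps a₁ a₂ y (t + T) = G.jumps a₁ a₂ y T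
      + G.jumps (a₁.shift T) (a₂.shift T) (fun s => y (s + T)) t := by
  classical
  have hlt : (T : ℝ≥0∞) ≤ ((t + T : ℝ≥0) : ℝ≥0∞) := by exact_mod_cast le_add_self
  rw [jumps, jumps, jumps, add_add_add_comm]
  congr 1
  · refine tsum_eq_tsum_add_tsum_shift T a₁.imp (fun m hm => ?_) (fun m hm => ?_) (fun m => ?_) ?_
    · exact if_congr (and_congr_left' ⟨fun _ => hm, fun _ => hm.trans_le hlt⟩) rfl rfl
    · exact if_neg fun h => hm h.1
    · rw [ENNReal.coe_add]
      rw [if_congr (effective_shift_iff T t m) rfl rfl]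
      refine ite_congr rfl (fun h => ?_) fun _ => rfl
      have := stateBefore_shift G.gξ T a₁.imp y (m := m) (h.1.trans_le le_top)
      rw [← this]
      rfl
    · refine summable_of_hasFiniteSupport (((a₁.shift T).imp.finite_time_lt t).subset fun m hm => ?_)
      by_contra h
      exact hm (if_neg fun h' => h h'.1)
  · refine tsum_eq_tsum_add_tsum_shift T a₂.imp (fun m hm => ?_) (fun m hm => ?_) (fun m => ?_) ?_
    · exact if_congr ⟨fun _ => hm, fun _ => hm.trans_le hlt⟩ rfl rfl
    · exact if_neg hm
    · rw [ENNReal.coe_add]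
      rw [if_congr (shift_time_lt_iff (T := T) (u := a₂.imp) (m := m) (t := t)) rfl rfl]
      refine ite_congr rfl (fun h => ?_) fun _ => rfl
      have := stateBefore_shift G.gη T a₂.imp y (m := m) (h.trans_le le_top)
      rw [← this]
      rfl
    · refine summable_of_hasFiniteSupport (((a₂.shift T).imp.finite_time_lt t).subset fun m hm => ?_)
      by_contra h
      exact hm (if_neg h)

/-- The flow property. -/
theorem trajectory_add (hb : G.HypDynamics) (x : EuclideanSpace ℝ (Fin n))
    (a₁ : GameControl G.A G.U) (a₂ : GameControl G.B G.V) (T t : ℝ≥0) :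
    G.trajectory x a₁ a₂ (t + T)
      = G.trajectory (G.trajectory x a₁ a₂ T) (a₁.shift T) (a₂.shift T) t := by
  set y := G.trajectory x a₁ a₂ with hy
  have h := isTrajectory_iff.1 (isTrajectory_trajectory hb x a₁ a₂)
  rw [← hy] at h
  -- The translate of `y` solves the state equation of the shifted controls from `y T`; uniqueness
  -- then identifies it.
  refine IsTrajectoryOn.eq_trajectory (T := t) (y := fun s => y (s + T)) hb (fun s _ => ?_) t le_rfl
  have hd : Set.EqOn (fun r : ℝ => G.drift a₁ a₂ y (r + T))
      (G.drift (a₁.shift T) (a₂.shift T) fun s => y (s + T)) (Set.uIoc (0 : ℝ) s) := fun r hr => by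
    rw [Set.uIoc_of_le s.coe_nonneg] at hr
    have : (r + T).toNNReal = r.toNNReal + T := by
      rw [Real.toNNReal_add hr.1.le T.coe_nonneg, Real.toNNReal_coe]
    simp only [drift, this]
    rfl
  have hT := h (s + T) T le_add_self
  have hsT := h (s + T) (s + T) le_rfl
  have hi : IntervalIntegrable (G.drift a₁ a₂ y) volume T (s + T : ℝ≥0) := hT.1.symm.trans hsT.1
  refine ⟨(intervalIntegrable_congr hd).1 ?_, ?_⟩
  · have := hi.comp_add_right (T : ℝ)
    simpa using this
  · rw [← intervalIntegral.integral_congr_ae (ae_of_all _ hd),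
      intervalIntegral.integral_comp_add_right (fun r => G.drift a₁ a₂ y r)]
    change y (s + T) = _
    rw [hsT.2, hT.2, ← intervalIntegral.integral_add_adjacent_intervals hT.1 hi, jumps_add, zero_add,
      NNReal.coe_add]
    abel

theorem discount_add {r : ℝ≥0∞} (hr : r ≠ ⊤) (T : ℝ≥0) :
    Real.exp (-G.lam * (T + r).toReal)
      = Real.exp (-G.lam * T) * Real.exp (-G.lam * r.toReal) := by
  rw [ENNReal.toReal_add ENNReal.coe_ne_top hr, ENNReal.coe_toReal, mul_add, Real.exp_add]

theorem costMax_top_eq (hb : G.HypDynamics) (x : EuclideanSpace ℝ (Fin n))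
    (a₁ : GameControl G.A G.U) (a₂ : GameControl G.B G.V) (T : ℝ≥0) :
    G.costMax ⊤ x a₁ a₂ = G.costMax T x a₁ a₂ + ENNReal.ofReal (Real.exp (-G.lam * T))
      * G.costMax ⊤ (G.trajectory x a₁ a₂ T) (a₁.shift T) (a₂.shift T) := by
  classical
  rw [costMax, costMax, costMax, ← ENNReal.tsum_mul_left]
  refine tsum_eq_tsum_add_tsum_shift T a₁.imp (fun m hm => ?_) (fun m hm => ?_) (fun m => ?_)
    ENNReal.summable
  · exact if_congr (and_congr_left' ⟨fun _ => hm, fun _ => hm.trans_le le_top⟩) rfl rfl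
  · exact if_neg fun h => hm h.1
  · have hiff := effective_shift_iff (a₁ := a₁) (a₂ := a₂) T ⊤ m
    rw [top_add] at hiff
    rw [if_congr hiff rfl rfl, mul_ite, mul_zero]
    refine ite_congr rfl (fun h => ?_) fun _ => rfl
    rw [← stateBefore_shift G.gξ T a₁.imp _ h.1, ← add_shift_time,
      discount_add (show (a₁.imp.shift T).time m ≠ ⊤ from h.1.ne),
      ← ENNReal.ofReal_mul (Real.exp_pos _).le, mul_left_comm]
    simp only [trajectory_add hb]
    rfl

theorem costMin_top_eq (hb : G.HypDynamics) (x : EuclideanSpace ℝ (Fin n))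
    (a₁ : GameControl G.A G.U) (a₂ : GameControl G.B G.V) (T : ℝ≥0) :
    G.costMin ⊤ x a₁ a₂ = G.costMin T x a₁ a₂ + ENNReal.ofReal (Real.exp (-G.lam * T))
      * G.costMin ⊤ (G.trajectory x a₁ a₂ T) (a₁.shift T) (a₂.shift T) := by
  classical
  rw [costMin, costMin, costMin, ← ENNReal.tsum_mul_left]
  refine tsum_eq_tsum_add_tsum_shift T a₂.imp (fun m hm => ?_) (fun m hm => ?_) (fun m => ?_)
    ENNReal.summable
  · exact if_congr ⟨fun _ => hm, fun _ => hm.trans_le le_top⟩ rfl rfl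
  · exact if_neg hm
  · have hiff := shift_time_lt_iff (T := T) (u := a₂.imp) (m := m) (t := ⊤)
    rw [top_add] at hiff
    rw [if_congr hiff rfl rfl, mul_ite, mul_zero]
    refine ite_congr rfl (fun h => ?_) fun _ => rfl
    rw [← stateBefore_shift G.gη T a₂.imp _ h, ← add_shift_time,
      discount_add (show (a₂.imp.shift T).time m ≠ ⊤ from h.ne),
      ← ENNReal.ofReal_mul (Real.exp_pos _).le, mul_left_comm]
    simp only [trajectory_add hb]
    rfl

theorem costMax_ne_top (T : ℝ≥0) (x : EuclideanSpace ℝ (Fin n))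
    (a₁ : GameControl G.A G.U) (a₂ : GameControl G.B G.V) : G.costMax T x a₁ a₂ ≠ ⊤ := by
  classical
  rw [costMax, tsum_eq_sum (s := (a₁.imp.finite_time_lt T).toFinset) fun m hm =>
    if_neg fun h => hm ((Set.Finite.mem_toFinset _).2 h.1)]
  refine ENNReal.sum_ne_top.2 fun m _ => ?_
  split_ifs <;> simp

theorem costMin_ne_top (T : ℝ≥0) (x : EuclideanSpace ℝ (Fin n))
    (a₁ : GameControl G.A G.U) (a₂ : GameControl G.B G.V) : G.costMin T x a₁ a₂ ≠ ⊤ := by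
  classical
  rw [costMin, tsum_eq_sum (s := (a₂.imp.finite_time_lt T).toFinset) fun m hm =>
    if_neg (c := a₂.imp.time m < T) fun h => hm ((Set.Finite.mem_toFinset _).2 h)]
  refine ENNReal.sum_ne_top.2 fun m _ => ?_
  split_ifs <;> simp

end Flow

/-! ### Measurability and splitting of the running gain -/

section Payoff

/-- The jump vectors do not depend on `t`, so each partial sum is a step function of `t`, and at
each `t` only finitely many terms are non-zero. -/
theorem measurable_jumps (a₁ : GameControl G.A G.U) (a₂ : GameControl G.B G.V)
    (y : ℝ≥0 → EuclideanSpace ℝ (Fin n)) : Measurable (G.jumps a₁ a₂ y) := by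
  classical
  have key : ∀ (s : ℕ → ℝ≥0∞) (P : ℕ → Prop) (v : ℕ → EuclideanSpace ℝ (Fin n)),
      (∀ t : ℝ≥0, {m | s m < t}.Finite) →
      Measurable fun t : ℝ≥0 => ∑' m, if s m < t ∧ P m then v m else 0 := by
    intro s P v hs
    refine measurable_of_tendsto_metrizable
      (f := fun N (t : ℝ≥0) => ∑ m ∈ Finset.range N, if s m < t ∧ P m then v m else 0)
      (fun N => Finset.measurable_sum _ fun m _ => ?_) (tendsto_pi_nhds.2 fun t => ?_)
    · by_cases hP : P m
      · simp only [hP, and_true]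
        exact Measurable.ite (measurableSet_lt measurable_const measurable_coe_nnreal_ennreal)
          measurable_const measurable_const
      · simp [hP]
    · refine (summable_of_hasFiniteSupport ((hs t).subset fun m hm => ?_)).hasSum.tendsto_sum_nat
      by_contra h
      exact hm (if_neg fun h' => h h'.1)
  have h1 := key a₁.imp.time (fun m => ∀ k, a₁.imp.time m ≠ a₂.imp.time k)
    (fun m => impulseJump G.gξ (stateBefore G.gξ a₁.imp y m) (a₁.imp.act m))
    a₁.imp.finite_time_lt
  have h2 := key a₂.imp.time (fun _ => True)
    (fun m => impulseJump G.gη (stateBefore G.gη a₂.imp y m) (a₂.imp.act m))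
    a₂.imp.finite_time_lt
  simp only [and_true] at h2
  have he : G.jumps a₁ a₂ y = _ + _ := funext fun t => by
    rw [jumps, Pi.add_apply]
  rw [he]
  exact h1.add h2

/-- Needed for the integrability of the gain along the trajectory. The state equation itself gives
it: the integral term is continuous and the jump term measurable. -/
theorem measurable_trajectory (hb : G.HypDynamics) (x : EuclideanSpace ℝ (Fin n))
    (a₁ : GameControl G.A G.U) (a₂ : GameControl G.B G.V) :
    Measurable (G.trajectory x a₁ a₂) := by
  set y := G.trajectory x a₁ a₂ with hy
  have h : ∀ t : ℝ≥0, IntervalIntegrable (G.drift a₁ a₂ y) volume 0 t ∧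
      y t = x + (∫ s in (0 : ℝ)..t, G.drift a₁ a₂ y s) + G.jumps a₁ a₂ y t := fun t =>
    isTrajectory_iff.1 (isTrajectory_trajectory hb x a₁ a₂) t t le_rfl
  have hc : Continuous fun t : ℝ≥0 => ∫ s in (0 : ℝ)..t, G.drift a₁ a₂ y s := by
    rw [continuous_iff_continuousAt]
    intro t
    have h1 := intervalIntegral.continuousOn_primitive_interval (μ := volume)
      (f := G.drift a₁ a₂ y) (a := 0) (b := ((t + 1 : ℝ≥0) : ℝ)) (by
        rw [Set.uIcc_of_le (NNReal.coe_nonneg _), integrableOn_Icc_iff_integrableOn_Ioc]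
        exact (intervalIntegrable_iff_integrableOn_Ioc_of_le (NNReal.coe_nonneg _)).1 (h _).1)
    rw [Set.uIcc_of_le (NNReal.coe_nonneg _)] at h1
    have h2 := h1 t ⟨t.coe_nonneg, by push_cast; linarith⟩
    refine ContinuousWithinAt.tendsto h2 |>.comp (tendsto_nhdsWithin_iff.2
      ⟨NNReal.continuous_coe.continuousAt, ?_⟩)
    filter_upwards [gt_mem_nhds (show t < t + 1 from lt_add_one t)] with s hs
    exact ⟨s.coe_nonneg, by exact_mod_cast hs.le⟩
  have he : y = fun t : ℝ≥0 => x + (∫ s in (0 : ℝ)..t, G.drift a₁ a₂ y s) + G.jumps a₁ a₂ y t :=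
    funext fun t => (h t).2
  rw [he]
  exact (measurable_const.add hc.measurable).add (measurable_jumps a₁ a₂ y)

theorem measurable_discountedGain (hb : G.HypDynamics) (hf : G.HypRunningGain)
    (x : EuclideanSpace ℝ (Fin n)) (a₁ : GameControl G.A G.U) (a₂ : GameControl G.B G.V) :
    Measurable (G.discountedGain x a₁ a₂) :=
  (measurable_comp_controls hf.continuous a₁ a₂
    ((measurable_trajectory hb x a₁ a₂).comp measurable_real_toNNReal)).mul (by fun_prop)

theorem integrableOn_exp_lam (hlam : 0 < G.lam) :
    IntegrableOn (fun t : ℝ => Real.exp (-G.lam * t)) (Set.Ioi 0) :=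
  exp_neg_integrableOn_Ioi 0 hlam

theorem integrableOn_discountedGain (hlam : 0 < G.lam) (hb : G.HypDynamics)
    (hf : G.HypRunningGain) (x : EuclideanSpace ℝ (Fin n)) (a₁ : GameControl G.A G.U)
    (a₂ : GameControl G.B G.V) : IntegrableOn (G.discountedGain x a₁ a₂) (Set.Ioi 0) := by
  obtain ⟨M, hM⟩ := hf.bounded
  refine ((integrableOn_exp_lam hlam).const_mul M).mono'
    (measurable_discountedGain hb hf x a₁ a₂).aestronglyMeasurable (ae_of_all _ fun t => ?_)
  rw [discountedGain, norm_mul, Real.norm_of_nonneg (Real.exp_pos _).le, Real.norm_eq_abs]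
  exact mul_le_mul_of_nonneg_right (hM _ _ _) (Real.exp_pos _).le

theorem exists_abs_integral_discountedGain_le (hlam : 0 < G.lam) (hf : G.HypRunningGain) :
    ∃ K : ℝ, ∀ x a₁ a₂, |∫ t in Set.Ioi (0 : ℝ), G.discountedGain x a₁ a₂ t| ≤ K := by
  obtain ⟨M, hM⟩ := hf.bounded
  refine ⟨∫ t in Set.Ioi (0 : ℝ), M * Real.exp (-G.lam * t), fun x a₁ a₂ => ?_⟩
  rw [← Real.norm_eq_abs]
  refine norm_integral_le_of_norm_le ((integrableOn_exp_lam hlam).const_mul M)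
    (ae_of_all _ fun t => ?_)
  rw [discountedGain, norm_mul, Real.norm_of_nonneg (Real.exp_pos _).le, Real.norm_eq_abs]
  exact mul_le_mul_of_nonneg_right (hM _ _ _) (Real.exp_pos _).le

theorem integral_discountedGain_eq (hlam : 0 < G.lam) (hb : G.HypDynamics)
    (hf : G.HypRunningGain) (x : EuclideanSpace ℝ (Fin n)) (a₁ : GameControl G.A G.U)
    (a₂ : GameControl G.B G.V) (T : ℝ≥0) :
    ∫ t in Set.Ioi (0 : ℝ), G.discountedGain x a₁ a₂ t
      = (∫ t in (0 : ℝ)..T, G.discountedGain x a₁ a₂ t) + Real.exp (-G.lam * T)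
        * ∫ t in Set.Ioi (0 : ℝ),
          G.discountedGain (G.trajectory x a₁ a₂ T) (a₁.shift T) (a₂.shift T) t := by
  have hi := integrableOn_discountedGain hlam hb hf x a₁ a₂
  have hi' : IntegrableOn (G.discountedGain x a₁ a₂) (Set.Ioi (T : ℝ)) :=
    hi.mono_set (Set.Ioi_subset_Ioi T.coe_nonneg)
  have h1 : ∫ t in Set.Ioi (T : ℝ), G.discountedGain x a₁ a₂ t
      = ∫ t in Set.Ioi (0 : ℝ), G.discountedGain x a₁ a₂ (t + T) := by
    have := (measurePreserving_add_right volume (T : ℝ)).setIntegral_preimage_emb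
      (measurableEmbedding_addRight (T : ℝ)) (G.discountedGain x a₁ a₂) (Set.Ioi (T : ℝ))
    rw [← this]
    simp
  rw [← integral_const_mul, ← intervalIntegral.integral_Ioi_sub_Ioi hi T.coe_nonneg]
  have h2 : ∫ t in Set.Ioi (0 : ℝ), G.discountedGain x a₁ a₂ (t + T)
      = ∫ t in Set.Ioi (0 : ℝ), Real.exp (-G.lam * T)
        * G.discountedGain (G.trajectory x a₁ a₂ T) (a₁.shift T) (a₂.shift T) t := by
    refine setIntegral_congr_fun measurableSet_Ioi fun r hr => ?_
    have : (r + T).toNNReal = r.toNNReal + T := by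
      rw [Real.toNNReal_add (le_of_lt hr) T.coe_nonneg, Real.toNNReal_coe]
    simp only [discountedGain, this, trajectory_add hb, mul_add, Real.exp_add, GameControl.shift]
    ring
  rw [h1, h2]
  ring

/-- The payoff accumulated before `T`. -/
noncomputable def payoffBefore (G : ImpulseGame n p q l) (T : ℝ≥0) (x : EuclideanSpace ℝ (Fin n))
    (a₁ : GameControl G.A G.U) (a₂ : GameControl G.B G.V) : ℝ :=
  (∫ t in (0 : ℝ)..T, G.discountedGain x a₁ a₂ t) - (G.costMax T x a₁ a₂).toReal
    + (G.costMin T x a₁ a₂).toReal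

theorem coe_payoffBefore (T : ℝ≥0) (x : EuclideanSpace ℝ (Fin n))
    (a₁ : GameControl G.A G.U) (a₂ : GameControl G.B G.V) :
    (G.payoffBefore T x a₁ a₂ : EReal)
      = ((∫ t in (0 : ℝ)..T, G.discountedGain x a₁ a₂ t : ℝ) : EReal)
        - (G.costMax T x a₁ a₂ : EReal) + (G.costMin T x a₁ a₂ : EReal) := by
  rw [payoffBefore, EReal.coe_add, EReal.coe_sub,
    EReal.coe_ennreal_toReal (costMax_ne_top T x a₁ a₂),
    EReal.coe_ennreal_toReal (costMin_ne_top T x a₁ a₂)]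

theorem payoffBefore_eq_of_agreeBefore (hb : G.HypDynamics) (h₁ : a₁.AgreeBefore T a₁')
    (h₂ : a₂.AgreeBefore T a₂') : G.payoffBefore T x a₁ a₂ = G.payoffBefore T x a₁' a₂' := by
  rw [payoffBefore, payoffBefore, integral_discountedGain_eq_of_agreeBefore hb h₁ h₂,
    costMax_eq_of_agreeBefore hb h₁ h₂, costMin_eq_of_agreeBefore hb h₁ h₂]

end Payoff

end ImpulseGame

/-! ### The dynamic programming principle for payoffs that split -/

section AbstractPrinciple

open GameControl

variable {l N N' : ℕ} {A B : Set (EuclideanSpace ℝ (Fin l))}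
  {U : ConvexCone ℝ (EuclideanSpace ℝ (Fin N))} {V : ConvexCone ℝ (EuclideanSpace ℝ (Fin N'))}

/-- Follow the strategy `β` before `T`, and from `T` on the strategy `γ a`, applied to the control
with time measured from `T`. -/
theorem nonAnticipative_concat {T : ℝ≥0} {β : GameControl A U → GameControl B V}
    (hβ : NonAnticipative β) {γ : GameControl A U → GameControl A U → GameControl B V}
    (hγ : ∀ a, NonAnticipative (γ a)) (hγ' : ∀ a a', a.AgreeBefore T a' → γ a = γ a') :
    NonAnticipative fun a => (β a).concat T (γ a (a.shift T)) := by
  intro t a a' h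
  rcases lt_or_ge t T with ht | ht
  · have h1 := hβ t a a' h
    refine ⟨fun s hs => ?_, fun m hm => ?_⟩
    · have hsT := hs.trans_lt ht
      rw [((β a).concat_agreeBefore T _).1 s hsT |>.trans (h1.1 s hs),
        ((β a').concat_agreeBefore T _).1 s hsT]
    · have htT : (t : ℝ≥0∞) < T := by exact_mod_cast ht
      rcases hm with hm | hm
      · have e := ((β a).concat_agreeBefore T (γ a (a.shift T))).2 m (Or.inl (hm.trans_lt htT))
        have e1 := h1.2 m (Or.inl (e.1 ▸ hm))
        have e' := ((β a').concat_agreeBefore T (γ a' (a'.shift T))).2 m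
          (Or.inr (e1.1 ▸ e.1 ▸ hm.trans_lt htT))
        exact ⟨e.1.trans (e1.1.trans e'.1.symm), e.2.trans (e1.2.trans e'.2.symm)⟩
      · have e := ((β a').concat_agreeBefore T (γ a' (a'.shift T))).2 m (Or.inl (hm.trans_lt htT))
        have e1 := h1.2 m (Or.inr (e.1 ▸ hm))
        have e' := ((β a).concat_agreeBefore T (γ a (a.shift T))).2 m
          (Or.inr (e1.1 ▸ e.1 ▸ hm.trans_lt htT))
        exact ⟨e'.1.trans (e1.1.trans e.1.symm), e'.2.trans (e1.2.trans e.2.symm)⟩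
  · obtain ⟨s, rfl⟩ := exists_add_of_le ht
    obtain ⟨hb, hs⟩ := agreeUpTo_add_iff.1 h
    refine agreeUpTo_add_iff.2 ⟨?_, ?_⟩
    · exact ((concat_agreeBefore T _ _).trans (hβ.agreeBefore hb)).trans
        (concat_agreeBefore T _ _).symm
    -- Equal pasts select the same continuation strategy, so only its response to the shifted
    -- controls remains to be compared.
    · rw [shift_concat, shift_concat, hγ' a a' hb]
      exact hγ a' s _ _ hs

/-- This is the strategy that `β` induces from `T` on, once the opponent has played `a` before `T`.
-/
theorem nonAnticipative_shift (T : ℝ≥0) {β : GameControl A U → GameControl B V}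
    (hβ : NonAnticipative β) (a : GameControl A U) :
    NonAnticipative fun a' => (β (a.concat T a')).shift T := fun t a' a'' h =>
  (agreeUpTo_add_iff.1 (hβ (T + t) _ _ (agreeUpTo_add_iff.2
    ⟨(concat_agreeBefore T a a').trans (concat_agreeBefore T a a'').symm, by
      rwa [shift_concat, shift_concat]⟩))).2

/-- The dynamic programming principle for a payoff that splits at time `T` into a part that depends
only on the controls before `T` and the discounted payoff from the state at time `T`. -/
theorem dynamicProgramming {X : Type*} {J : X → GameControl A U → GameControl B V → EReal}
    {R : X → GameControl A U → GameControl B V → ℝ} {z : X → GameControl A U → GameControl B V → X}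
    {T : ℝ≥0} {e : ℝ} (he : 0 < e)
    (hJ : ∀ x a b, J x a b = (R x a b : EReal) + J (z x a b) (a.shift T) (b.shift T) * (e : EReal))
    (hR : ∀ x a a' b b', a.AgreeBefore T a' → b.AgreeBefore T b' → R x a b = R x a' b')
    (hz : ∀ x a a' b b', a.AgreeBefore T a' → b.AgreeBefore T b' → z x a b = z x a' b')
    {W : X → EReal}
    (hW : ∀ x, W x = ⨅ β : {β : GameControl A U → GameControl B V // NonAnticipative β},
      ⨆ a, J x a (β.1 a))
    (hbot : ∀ x, W x ≠ ⊥) (htop : ∀ x, W x ≠ ⊤) (x : X) :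
    W x = ⨅ β : {β : GameControl A U → GameControl B V // NonAnticipative β},
      ⨆ a, ((R x a (β.1 a) : EReal) + W (z x a (β.1 a)) * (e : EReal)) := by
  -- Finiteness reduces the values to real numbers; only `J` can still be infinite.
  obtain ⟨w, rfl⟩ : ∃ w : X → ℝ, W = fun x => (w x : EReal) :=
    ⟨fun x => (W x).toReal, funext fun x => (EReal.coe_toReal (htop x) (hbot x)).symm⟩
  beta_reduce at hW ⊢
  have he' : (0 : EReal) ≤ e := by exact_mod_cast he.le
  apply le_antisymm
  · refine le_iInf fun β => ?_
    rw [← EReal.le_of_forall_lt_iff_le]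
    intro S hS
    obtain ⟨S', hS', hSS'⟩ := EReal.lt_iff_exists_real_btwn.1 hS
    -- An error of `(S - S') / e` at time `T` becomes `S - S'` after discounting by `e`.
    have hε : 0 < (S - S') / e := div_pos (sub_pos.2 (by exact_mod_cast hSS')) he
    -- Strategies need not depend measurably on the state, so a nearly optimal one can be chosen
    -- separately for each state.
    have hγ : ∀ x, ∃ γ : {β : GameControl A U → GameControl B V // NonAnticipative β},
        ⨆ a, J x a (γ.1 a) < ((w x + (S - S') / e : ℝ) : EReal) := fun x => by
      rw [← iInf_lt_iff, ← hW]
      exact_mod_cast lt_add_of_pos_right _ hε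
    choose γ hγ using hγ
    have hna := nonAnticipative_concat (T := T) β.2
      (γ := fun a => (γ (z x a (β.1 a))).1) (fun a => (γ _).2) fun a a' h => by
        rw [hz x a a' _ _ h (β.2.agreeBefore h)]
    refine (hW x).le.trans ((iInf_le _ ⟨_, hna⟩).trans (iSup_le fun a => ?_))
    have hb := concat_agreeBefore T (β.1 a) ((γ (z x a (β.1 a))).1 (a.shift T))
    have ha : a.AgreeBefore T a := ⟨fun _ _ => rfl, fun _ _ => ⟨rfl, rfl⟩⟩
    rw [hJ]
    simp only
    rw [hR x a a _ _ ha hb, hz x a a _ _ ha hb, shift_concat]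
    have h1 : J (z x a (β.1 a)) (a.shift T) ((γ (z x a (β.1 a))).1 (a.shift T))
        ≤ ((w (z x a (β.1 a)) + (S - S') / e : ℝ) : EReal) :=
      (le_iSup (fun c => J (z x a (β.1 a)) c ((γ (z x a (β.1 a))).1 c)) _).trans (hγ _).le
    have h2 : ((R x a (β.1 a) + w (z x a (β.1 a)) * e : ℝ) : EReal) ≤ (S' : EReal) := by
      refine le_trans ?_ hS'.le
      rw [EReal.coe_add, EReal.coe_mul]
      exact le_iSup (fun a => ((R x a (β.1 a) : EReal) + (w (z x a (β.1 a)) : EReal) * (e : EReal))) a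
    calc _ ≤ (R x a (β.1 a) : EReal)
          + ((w (z x a (β.1 a)) + (S - S') / e : ℝ) : EReal) * (e : EReal) :=
          add_le_add_right (mul_le_mul_of_nonneg_right h1 he') _
      _ = ((R x a (β.1 a) + w (z x a (β.1 a)) * e + (S - S') : ℝ) : EReal) := by
          norm_cast
          field_simp
          ring
      _ ≤ S := by
          have : R x a (β.1 a) + w (z x a (β.1 a)) * e ≤ S' := by exact_mod_cast h2
          exact_mod_cast (by linarith)
  · rw [hW x]
    refine le_iInf fun β => (iInf_le _ β).trans (iSup_le fun a => ?_)
    rw [← EReal.le_of_forall_lt_iff_le]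
    intro S hS
    have hna := nonAnticipative_shift T β.2 a
    -- Against the induced strategy, playing `a'` amounts to playing `a.concat T a'` against `β`,
    -- which yields at most `S`.
    have h1 : (w (z x a (β.1 a)) : EReal) ≤ (((S - R x a (β.1 a)) / e : ℝ) : EReal) := by
      rw [hW]
      refine (iInf_le _ ⟨_, hna⟩).trans (iSup_le fun a' => ?_)
      have ha := concat_agreeBefore T a a'
      have h2 := (le_iSup (fun a => J x a (β.1 a)) (a.concat T a')).trans hS.le
      rw [hJ, hR x _ a _ _ ha (β.2.agreeBefore ha), hz x _ a _ _ ha (β.2.agreeBefore ha),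
        shift_concat] at h2
      simp only
      induction hj : J (z x a (β.1 a)) a' ((β.1 (a.concat T a')).shift T) with
      | bot => exact bot_le
      | top =>
        rw [hj, EReal.top_mul_coe_of_pos he, EReal.coe_add_top] at h2
        exact absurd (top_le_iff.1 h2) (EReal.coe_ne_top S)
      | coe j =>
        rw [hj] at h2
        have : R x a (β.1 a) + j * e ≤ S := by exact_mod_cast h2
        rw [EReal.coe_le_coe_iff, le_div_iff₀ he]
        linarith
    have h2 : w (z x a (β.1 a)) ≤ (S - R x a (β.1 a)) / e := by exact_mod_cast h1
    rw [le_div_iff₀ he] at h2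
    exact_mod_cast (by linarith : R x a (β.1 a) + w (z x a (β.1 a)) * e ≤ S)

end AbstractPrinciple

theorem EReal.neg_iSup_iInf {ι κ : Sort*} (f : ι → κ → EReal) :
    -(⨆ i, ⨅ j, f i j) = ⨅ i, ⨆ j, -f i j := by
  have h := EReal.negOrderIso.map_iSup fun i => ⨅ j, f i j
  simp only [OrderIso.map_iInf] at h
  exact h

/-! ### Splitting the payoff in the extended reals -/

namespace ImpulseGame

variable {n p q l : ℕ} {G : ImpulseGame n p q l}

/-- Infinite costs can only arise after `T`. An infinite `costMax` gives `⊥` on both sides, whatever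
`costMin` is; otherwise an infinite `costMin` gives `⊤` on both. The positive discount factor
preserves either value, and the finite case is addition of the three splittings. -/
theorem J_eq_payoffBefore_add (hlam : 0 < G.lam) (hb : G.HypDynamics)
    (hf : G.HypRunningGain) (x : EuclideanSpace ℝ (Fin n)) (a₁ : GameControl G.A G.U)
    (a₂ : GameControl G.B G.V) (T : ℝ≥0) :
    G.J x a₁ a₂ = (G.payoffBefore T x a₁ a₂ : EReal)
      + G.J (G.trajectory x a₁ a₂ T) (a₁.shift T) (a₂.shift T)
        * ((Real.exp (-G.lam * T) : ℝ) : EReal) := by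
  rw [J, J, payoffBefore, integral_discountedGain_eq hlam hb hf x a₁ a₂ T,
    costMax_top_eq hb x a₁ a₂ T, costMin_top_eq hb x a₁ a₂ T]
  have hc := costMax_ne_top T x a₁ a₂
  have hd := costMin_ne_top T x a₁ a₂
  generalize G.costMax T x a₁ a₂ = c at *
  generalize G.costMin T x a₁ a₂ = d at *
  generalize G.costMax ⊤ _ (a₁.shift T) (a₂.shift T) = c'
  generalize G.costMin ⊤ _ (a₁.shift T) (a₂.shift T) = d'
  generalize (∫ t in (0 : ℝ)..T, G.discountedGain x a₁ a₂ t) = I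
  generalize (∫ t in Set.Ioi (0 : ℝ),
    G.discountedGain (G.trajectory x a₁ a₂ T) (a₁.shift T) (a₂.shift T) t) = I'
  have he := Real.exp_pos (-G.lam * T)
  generalize Real.exp (-G.lam * T) = e at *
  lift c to ℝ≥0 using hc
  lift d to ℝ≥0 using hd
  lift e to ℝ≥0 using he.le
  have he' : (e : ℝ≥0∞) ≠ 0 := by
    have : (0 : ℝ≥0) < e := by exact_mod_cast he
    exact_mod_cast this.ne'
  rw [ENNReal.ofReal_coe_nnreal]
  induction c' with
  | top =>
    rw [ENNReal.mul_top he', add_top, EReal.coe_ennreal_top]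
    simp only [sub_eq_add_neg, EReal.neg_top, EReal.add_bot, EReal.bot_add,
      EReal.bot_mul_coe_of_pos he]
  | coe c' =>
    induction d' with
    | top =>
      rw [ENNReal.mul_top he', add_top, EReal.coe_ennreal_top]
      simp only [← ENNReal.coe_mul, ← ENNReal.coe_add, EReal.coe_nnreal_eq_coe_real,
        ← EReal.coe_sub, EReal.coe_add_top, EReal.top_mul_coe_of_pos he]
    | coe d' =>
      simp only [← ENNReal.coe_mul, ← ENNReal.coe_add, EReal.coe_nnreal_eq_coe_real,
        ← EReal.coe_sub, ← EReal.coe_add, ← EReal.coe_mul, EReal.coe_eq_coe_iff,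
        ENNReal.coe_toReal, NNReal.coe_add, NNReal.coe_mul]
      ring

end ImpulseGame

/-! ### Finiteness of the values -/

/-- The control without impulses. -/
def ImpulseControl.never {N : ℕ} {U : ConvexCone ℝ (EuclideanSpace ℝ (Fin N))} (ξ : U) :
    ImpulseControl U where
  time _ := ⊤
  act _ := ξ
  monotone_time := monotone_const
  tendsto_time := tendsto_const_nhds

/-- A constant control without impulses. -/
def GameControl.idle {l N : ℕ} {A : Set (EuclideanSpace ℝ (Fin l))}
    {U : ConvexCone ℝ (EuclideanSpace ℝ (Fin N))} (θ : A) (ξ : U) : GameControl A U where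
  cont _ := θ
  measurable_cont := measurable_const
  imp := ImpulseControl.never ξ

namespace ImpulseGame

variable {n p q l : ℕ} {G : ImpulseGame n p q l}

theorem costMax_idle (T : ℝ≥0∞) (x : EuclideanSpace ℝ (Fin n)) (θ : G.A) (ξ : G.U)
    (a₂ : GameControl G.B G.V) : G.costMax T x (GameControl.idle θ ξ) a₂ = 0 := by
  simp [costMax, GameControl.idle, ImpulseControl.never]

theorem costMin_idle (T : ℝ≥0∞) (x : EuclideanSpace ℝ (Fin n)) (a₁ : GameControl G.A G.U)
    (θ : G.B) (η : G.V) : G.costMin T x a₁ (GameControl.idle θ η) = 0 := by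
  simp [costMin, GameControl.idle, ImpulseControl.never]

/-- An idle maximizer pays nothing while the costs of the minimizer only raise `J`; for an idle
minimizer the signs are reversed. Constant idle strategies then bound both values. -/
theorem exists_J_idle_bounds (hlam : 0 < G.lam) (hf : G.HypRunningGain) :
    ∃ K : ℝ, (∀ x θ ξ a₂, ((-K : ℝ) : EReal) ≤ G.J x (GameControl.idle θ ξ) a₂) ∧
      ∀ x a₁ θ η, G.J x a₁ (GameControl.idle θ η) ≤ (K : EReal) := by
  obtain ⟨K, hK⟩ := exists_abs_integral_discountedGain_le hlam hf
  refine ⟨K, fun x θ ξ a₂ => ?_, fun x a₁ θ η => ?_⟩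
  · rw [J, costMax_idle, EReal.coe_ennreal_zero, sub_zero]
    refine le_add_of_le_of_nonneg ?_ (EReal.coe_ennreal_nonneg _)
    exact_mod_cast (abs_le.1 (hK _ _ _)).1
  · rw [J, costMin_idle, EReal.coe_ennreal_zero, add_zero]
    refine (EReal.sub_le_sub le_rfl (EReal.coe_ennreal_nonneg _)).trans ?_
    rw [sub_zero]
    exact_mod_cast (abs_le.1 (hK _ _ _)).2

theorem values_finite (hG : G.Standing) (hf : G.HypRunningGain) (x : EuclideanSpace ℝ (Fin n)) :
    G.lowerValue x ≠ ⊥ ∧ G.lowerValue x ≠ ⊤ ∧ G.upperValue x ≠ ⊥ ∧ G.upperValue x ≠ ⊤ := by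
  obtain ⟨K, h1, h2⟩ := exists_J_idle_bounds hG.lam_pos hf
  obtain ⟨θ₁, hθ₁⟩ := hG.nonempty_A
  obtain ⟨θ₂, hθ₂⟩ := hG.nonempty_B
  obtain ⟨ξ, hξ⟩ := hG.nonempty_U
  obtain ⟨η, hη⟩ := hG.nonempty_V
  let i₁ : GameControl G.A G.U := GameControl.idle ⟨θ₁, hθ₁⟩ ⟨ξ, hξ⟩
  let i₂ : GameControl G.B G.V := GameControl.idle ⟨θ₂, hθ₂⟩ ⟨η, hη⟩
  have hl : ((-K : ℝ) : EReal) ≤ G.lowerValue x :=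
    le_iInf fun β => (h1 x _ _ _).trans (le_iSup (fun a => G.J x a (β.1 a)) i₁)
  have hl' : G.lowerValue x ≤ (K : EReal) :=
    iInf_le_of_le ⟨fun _ => i₂, nonAnticipative_const i₂⟩ (iSup_le fun a => h2 x a _ _)
  have hu : ((-K : ℝ) : EReal) ≤ G.upperValue x :=
    le_iSup_of_le ⟨fun _ => i₁, nonAnticipative_const i₁⟩ (le_iInf fun a => h1 x _ _ a)
  have hu' : G.upperValue x ≤ (K : EReal) :=
    iSup_le fun α => (iInf_le (fun a => G.J x (α.1 a) a) i₂).trans (h2 x _ _ _)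
  exact ⟨((EReal.bot_lt_coe _).trans_le hl).ne', (hl'.trans_lt (EReal.coe_lt_top _)).ne,
    ((EReal.bot_lt_coe _).trans_le hu).ne', (hu'.trans_lt (EReal.coe_lt_top _)).ne⟩

end ImpulseGame

/-! ### The principle for both value functions -/

theorem mainTheorem3 {n p q l : ℕ} (G : ImpulseGame n p q l) (hG : G.Standing)
    (hb : G.HypDynamics) (hg : G.HypImpulseForm) (hf : G.HypRunningGain) (hc : G.HypImpulseCost) :
    (∀ x, G.lowerValue x ≠ ⊥ ∧ G.lowerValue x ≠ ⊤ ∧ G.upperValue x ≠ ⊥ ∧ G.upperValue x ≠ ⊤) ∧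
    ∀ (x : EuclideanSpace ℝ (Fin n)) (T : ℝ≥0), 0 < T →
      G.lowerValue x =
        (⨅ β : G.StrategyMin, ⨆ a₁ : GameControl G.A G.U,
          ((∫ t in (0 : ℝ)..T, G.discountedGain x a₁ (β.1 a₁) t : ℝ) : EReal)
            - (G.costMax T x a₁ (β.1 a₁) : EReal)
            + (G.costMin T x a₁ (β.1 a₁) : EReal)
            + G.lowerValue (G.trajectory x a₁ (β.1 a₁) T)
              * ((Real.exp (-G.lam * T) : ℝ) : EReal)) ∧
      G.upperValue x =
        (⨆ α : G.StrategyMax, ⨅ a₂ : GameControl G.B G.V,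
          ((∫ t in (0 : ℝ)..T, G.discountedGain x (α.1 a₂) a₂ t : ℝ) : EReal)
            - (G.costMax T x (α.1 a₂) a₂ : EReal)
            + (G.costMin T x (α.1 a₂) a₂ : EReal)
            + G.upperValue (G.trajectory x (α.1 a₂) a₂ T)
              * ((Real.exp (-G.lam * T) : ℝ) : EReal)) := by
  have hfin := ImpulseGame.values_finite hG hf
  refine ⟨hfin, fun x T _ => ⟨?_, ?_⟩⟩
  · simp only [← ImpulseGame.coe_payoffBefore]
    exact dynamicProgramming (J := G.J) (R := G.payoffBefore T)
      (z := fun x a₁ a₂ => G.trajectory x a₁ a₂ T) (W := G.lowerValue) (Real.exp_pos _)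
      (fun x a₁ a₂ => ImpulseGame.J_eq_payoffBefore_add hG.lam_pos hb hf x a₁ a₂ T)
      (fun x a a' b b' h h' => ImpulseGame.payoffBefore_eq_of_agreeBefore hb h h')
      (fun x a a' b b' h h' => ImpulseGame.trajectory_eq_of_agreeBefore hb h h' le_rfl)
      (fun x => rfl) (fun x => (hfin x).1) (fun x => (hfin x).2.1) x
  · simp only [← ImpulseGame.coe_payoffBefore]
    -- Negation exchanges the players. The convention for two infinite costs is not symmetric, but
    -- only the splitting identity is used, and it survives negation because the part before `T` is
    -- real.
    rw [← neg_inj, EReal.neg_iSup_iInf]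
    have hneg : ∀ (r e : ℝ) (w : EReal),
        -((r : EReal) + w * (e : EReal)) = ((-r : ℝ) : EReal) + -w * (e : EReal) := by
      intro r e w
      rw [EReal.neg_add (Or.inl (EReal.coe_ne_bot r)) (Or.inl (EReal.coe_ne_top r)),
        sub_eq_add_neg, EReal.coe_neg, EReal.neg_mul]
    simp only [hneg]
    exact dynamicProgramming (J := fun x a₂ a₁ => -G.J x a₁ a₂)
      (R := fun x a₂ a₁ => -G.payoffBefore T x a₁ a₂)
      (z := fun x a₂ a₁ => G.trajectory x a₁ a₂ T) (W := fun x => -G.upperValue x) (Real.exp_pos _)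
      (fun x a₂ a₁ => by
        rw [ImpulseGame.J_eq_payoffBefore_add hG.lam_pos hb hf x a₁ a₂ T, hneg])
      (fun x a a' b b' h h' => by rw [ImpulseGame.payoffBefore_eq_of_agreeBefore hb h' h])
      (fun x a a' b b' h h' => ImpulseGame.trajectory_eq_of_agreeBefore hb h' h le_rfl)
      (fun x => EReal.neg_iSup_iInf _) (fun x => by simpa using (hfin x).2.2.2)
      (fun x => by simpa using (hfin x).2.2.1) x
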